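/- Let $d\ge 0$, let $X\subseteq\mathbb R^d$ be open, and let $\psi:X\to X$ be smooth and bijective with $\det J\psi(x)\neq 0$ for every $x\in X$, where $J\psi$ denotes the Jacobian matrix. Let $\mathscr D(X)$ be the space of complex-valued test functions on $X$ with its usual locally convex topology, and let $\mathscr D'(X)$ be the space of distributions on $X$ with the strong dual topology. Let $C_\psi$ be the composition operator on $\mathscr D'(X)$, i.e. the unique continuous linear operator on $\mathscr D'(X)$ which extends $f\mapsto f\circ\psi$ on $C(X)$; explicitly, $$\langle C_\psi u,\varphi\rangle=\Big\langle u,\frac{\varphi}{|\det J\psi|}\circ\psi^{-1}\Big\rangle\qquad(u\in\mathscr D'(X),\ \varphi\in\mathscr D(X)).$$ Then the following are equivalent. (i) $C_\psi$ is power bounded on $\mathscr D'(X)$, i.e. for every continuous seminorm $p$ on $\mathscr D'(X)$ there is a continuous seminorm $q$ on $\mathscr D'(X)$ such that $p(C_\psi^m u)\le q(u)$ for all $m\in\mathbb N_0$ and all $u\in\mathscr D'(X)$. (ii) $\psi$ has stable orbits, i.e. for every compact $K\subseteq X$ there is a compact $L\subseteq X$ such that $\psi^m(K)\subseteq L$ for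 all $m\in\mathbb N_0$; and for every compact $K\subseteq X$, every $n\in\mathbb N_0$ and every $1\le c\le d$, $$\sup_{m\in\mathbb N_0}\ \sup_{|\alpha|\le n,\ x\in\psi^m(K)}\big|\partial^\alpha(\psi^{-m})_c(x)\big|<\infty,$$ where $\psi^{-m}=(\psi^{-1})^m$ and $(\psi^{-m})_c$ denotes its $c$-th component. -/

import Mathlib

open Set Filter MeasureTheory TopologicalSpace
open scoped Topology ContDiff ENNReal Distributions

namespace CompositionOp

/-- Euclidean space `ℝ^d`. -/
abbrev Euc (d : ℕ) : Type := EuclideanSpace ℝ (Fin d)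

/-- The space `𝓓'(X)` of (complex) distributions on the open set `X ⊆ ℝ^d`: the continuous
`ℂ`-linear forms on the LF-space `𝓓(X)` of complex test functions. The topology which Mathlib
puts on this space of continuous linear forms is the strong dual topology (uniform convergence
on the bounded subsets of `𝓓(X)`). -/
abbrev Distr {d : ℕ} (X : Opens (Euc d)) : Type := 𝓓(X, ℂ) →L[ℂ] ℂ

/-- A continuous linear operator `T` on a (locally convex) space `E` is *power bounded* if for
every continuous seminorm `p` there is a continuous seminorm `q` with `p (T^m x) ≤ q x` for all
`m` and `x`. -/
def PowerBounded {E : Type*} [AddCommGroup E] [Module ℂ E] [TopologicalSpace E]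
    (T : E →L[ℂ] E) : Prop :=
  ∀ p : Seminorm ℂ E, Continuous p → ∃ q : Seminorm ℂ E, Continuous q ∧
    ∀ (m : ℕ) (x : E), p ((T ^ m) x) ≤ q x

/-- `ψ` (a self map of the set `X`) has *stable orbits*. -/
def StableOrbits {E : Type*} [TopologicalSpace E] (X : Set E) (ψ : E → E) : Prop :=
  ∀ K ⊆ X, IsCompact K → ∃ L ⊆ X, IsCompact L ∧ ∀ m : ℕ, ψ^[m] '' K ⊆ L

/-- `‖f‖_{n,K} = sup {|∂^α f (x)| ; |α| ≤ n, x ∈ K}`, as a value in `[0, ∞]`. The partial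
derivatives of order `k` are the values of the `k`-th derivative on `k`-tuples of standard unit
vectors. -/
noncomputable def cnNorm {d : ℕ} (n : ℕ) (K : Set (Euc d)) (f : Euc d → ℝ) : ℝ≥0∞ :=
  ⨆ x ∈ K, ⨆ k ∈ Set.Iic n, ⨆ s : Fin k → Fin d,
    ‖iteratedFDeriv ℝ k f x (fun j => EuclideanSpace.single (s j) (1 : ℝ))‖ₑ

/-- A smooth bijective symbol on `X` with nowhere vanishing Jacobian determinant. -/
structure IsSymbol {d : ℕ} (X : Opens (Euc d)) (ψ : Euc d → Euc d) : Prop where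
  smooth : ContDiffOn ℝ ∞ ψ X
  bij : BijOn ψ X X
  det_ne : ∀ x ∈ X, (fderiv ℝ ψ x).det ≠ 0

/-- The inverse of `ψ : X → X` (only its values on `X` matter). -/
noncomputable def invSymbol {d : ℕ} (X : Opens (Euc d)) (ψ : Euc d → Euc d) : Euc d → Euc d :=
  Function.invFunOn ψ X

section Aux

variable {d : ℕ} {X : Opens (Euc d)} {ψ : Euc d → Euc d}

theorem IsSymbol.apply_inv (h : IsSymbol X ψ) {y : Euc d} (hy : y ∈ X) :
    ψ (invSymbol X ψ y) = y :=
  h.bij.surjOn.rightInvOn_invFunOn hy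

theorem IsSymbol.inv_mem (h : IsSymbol X ψ) {y : Euc d} (hy : y ∈ X) : invSymbol X ψ y ∈ X :=
  h.bij.surjOn.mapsTo_invFunOn hy

theorem IsSymbol.inv_apply (h : IsSymbol X ψ) {x : Euc d} (hx : x ∈ X) :
    invSymbol X ψ (ψ x) = x :=
  h.bij.injOn.leftInvOn_invFunOn hx

theorem IsSymbol.contDiffAt (h : IsSymbol X ψ) {x : Euc d} (hx : x ∈ X) :
    ContDiffAt ℝ ∞ ψ x :=
  h.smooth.contDiffAt (X.isOpen.mem_nhds hx)

theorem IsSymbol.contDiffOn_inv (h : IsSymbol X ψ) : ContDiffOn ℝ ∞ (invSymbol X ψ) X := by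
  intro y hy
  apply ContDiffAt.contDiffWithinAt
  have hx := h.inv_mem hy
  have hyx := h.apply_inv hy
  set x := invSymbol X ψ y with hxdef
  have hs := h.contDiffAt hx
  have hd : HasFDerivAt ψ
      (((fderiv ℝ ψ x).toContinuousLinearEquivOfDetNeZero (h.det_ne x hx) :
        Euc d ≃L[ℝ] Euc d) : Euc d →L[ℝ] Euc d) x := by
    exact (hs.differentiableAt (by simp)).hasFDerivAt
  have hg := hs.to_localInverse hd (by simp)
  rw [hyx] at hg
  refine hg.congr_of_eventuallyEq ?_
  have hst := hs.hasStrictFDerivAt' hd (by simp)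
  have h1 : ∀ᶠ z in 𝓝 x, invSymbol X ψ (ψ z) = z := by
    filter_upwards [X.isOpen.mem_nhds hx] with z hz using h.inv_apply hz
  have h2 := hst.localInverse_unique h1
  rw [hyx] at h2
  exact h2

theorem contDiff_det : ContDiff ℝ ∞ (fun L : Euc d →L[ℝ] Euc d => L.det) := by
  have : (fun L : Euc d →L[ℝ] Euc d => L.det) = fun L =>
      ∑ σ : Equiv.Perm (Fin d), ((Equiv.Perm.sign σ : ℤ) : ℝ) *
        ∏ i, (L (EuclideanSpace.single i (1 : ℝ))) (σ i) := by
    funext L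
    have h1 : L.det = LinearMap.det (L : Euc d →ₗ[ℝ] Euc d) := rfl
    rw [h1, ← LinearMap.det_toMatrix (EuclideanSpace.basisFun (Fin d) ℝ).toBasis,
      Matrix.det_apply']
    simp [LinearMap.toMatrix_apply]
  rw [this]
  refine ContDiff.sum fun σ _ => contDiff_const.mul (contDiff_prod fun i _ => ?_)
  exact (EuclideanSpace.proj (𝕜 := ℝ) (σ i)).contDiff.comp
    (contDiff_id.clm_apply contDiff_const)

/-- The density `1 / |det Jψ|`, composed with `ψ⁻¹`. -/
noncomputable def weight (X : Opens (Euc d)) (ψ : Euc d → Euc d) (y : Euc d) : ℝ :=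
  |(fderiv ℝ ψ (invSymbol X ψ y)).det|⁻¹

theorem IsSymbol.contDiffOn_weight (h : IsSymbol X ψ) : ContDiffOn ℝ ∞ (weight X ψ) X := by
  have h1 : ContDiffOn ℝ ∞ (fun x => (fderiv ℝ ψ x).det) X :=
    contDiff_det.comp_contDiffOn (h.smooth.fderiv_of_isOpen X.isOpen (by simp))
  have h2 : ContDiffOn ℝ ∞ (fun y => (fderiv ℝ ψ (invSymbol X ψ y)).det) X :=
    h1.comp h.contDiffOn_inv fun y hy => h.inv_mem hy
  intro y hy
  have hne := h.det_ne _ (h.inv_mem hy)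
  have h3 : ContDiffWithinAt ℝ ∞ (fun y => |(fderiv ℝ ψ (invSymbol X ψ y)).det|) X y :=
    ContDiffAt.comp_contDiffWithinAt (g := fun t : ℝ => |t|) y (contDiffAt_abs hne) (h2 y hy)
  exact h3.inv (abs_ne_zero.2 hne)

/-- The function `(φ / |det Jψ|) ∘ ψ⁻¹` on `X`, extended by zero. -/
noncomputable def pushFun (X : Opens (Euc d)) (ψ : Euc d → Euc d) (φ : Euc d → ℂ) :
    Euc d → ℂ :=
  (X : Set (Euc d)).indicator fun y => weight X ψ y • φ (invSymbol X ψ y)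

theorem pushFun_of_mem {φ : Euc d → ℂ} {y : Euc d} (hy : y ∈ X) :
    pushFun X ψ φ y = weight X ψ y • φ (invSymbol X ψ y) :=
  Set.indicator_of_mem (s := (X : Set (Euc d))) hy _

theorem IsSymbol.isCompact_image (h : IsSymbol X ψ) {K : Set (Euc d)} (hK : IsCompact K)
    (hKX : K ⊆ X) : IsCompact (ψ '' K) :=
  hK.image_of_continuousOn (h.smooth.continuousOn.mono hKX)

theorem IsSymbol.image_subset (h : IsSymbol X ψ) {K : Set (Euc d)} (hKX : K ⊆ X) :
    ψ '' K ⊆ X :=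
  (Set.image_mono hKX).trans h.bij.image_eq.subset

theorem IsSymbol.support_pushFun (h : IsSymbol X ψ) {K : Set (Euc d)} {φ : Euc d → ℂ}
    (hφ : Function.support φ ⊆ K) : Function.support (pushFun X ψ φ) ⊆ ψ '' K := by
  intro y hy
  by_cases hyX : y ∈ X
  · rw [Function.mem_support, pushFun_of_mem hyX] at hy
    exact ⟨_, hφ (right_ne_zero_of_smul hy), h.apply_inv hyX⟩
  · exact absurd (Set.indicator_of_notMem (s := (X : Set (Euc d))) hyX _) hy

theorem IsSymbol.contDiffOn_smul (h : IsSymbol X ψ) {φ : Euc d → ℂ} (hφ : ContDiff ℝ ∞ φ) :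
    ContDiffOn ℝ ∞ (fun y => weight X ψ y • (φ ∘ invSymbol X ψ) y) X :=
  h.contDiffOn_weight.smul (hφ.comp_contDiffOn h.contDiffOn_inv)

theorem IsSymbol.contDiff_pushFun (h : IsSymbol X ψ) {K : Set (Euc d)} (hK : IsCompact K)
    (hKX : K ⊆ X) {φ : Euc d → ℂ} (hφ : ContDiff ℝ ∞ φ) (hs : Function.support φ ⊆ K) :
    ContDiff ℝ ∞ (pushFun X ψ φ) := by
  rw [contDiff_iff_contDiffAt]
  intro y
  by_cases hy : y ∈ X
  · refine ((h.contDiffOn_smul hφ).contDiffAt (X.isOpen.mem_nhds hy)).congr_of_eventuallyEq ?_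
    filter_upwards [X.isOpen.mem_nhds hy] with z hz using pushFun_of_mem hz
  · have hy' : (ψ '' K)ᶜ ∈ 𝓝 y :=
      (h.isCompact_image hK hKX).isClosed.isOpen_compl.mem_nhds
        fun hy' => hy (h.image_subset hKX hy')
    refine (contDiffAt_const (c := (0 : ℂ))).congr_of_eventuallyEq ?_
    filter_upwards [hy'] with z hz
    by_contra hne
    exact hz (h.support_pushFun hs hne)

/-- Uniform bounds for the derivatives of order at most `i` of a smooth function on a compact
set. -/
theorem exists_bound {F : Type*} [NormedAddCommGroup F] [NormedSpace ℝ F] {g : Euc d → F}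
    (hg : ContDiffOn ℝ ∞ g X) {K : Set (Euc d)} (hK : IsCompact K) (hKX : K ⊆ X) (i : ℕ) :
    ∃ C : ℝ, 1 ≤ C ∧ ∀ j ≤ i, ∀ x ∈ K, ‖iteratedFDerivWithin ℝ j g X x‖ ≤ C := by
  have key : ∀ j : ℕ, ∃ C : ℝ, ∀ x ∈ K, ‖iteratedFDerivWithin ℝ j g X x‖ ≤ C := fun j =>
    hK.exists_bound_of_continuousOn
      ((hg.continuousOn_iteratedFDerivWithin (by exact_mod_cast le_top)
        X.isOpen.uniqueDiffOn).mono hKX)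
  choose C hC using key
  refine ⟨1 + ∑ j ∈ Finset.range (i + 1), |C j|, ?_, fun j hj x hx => ?_⟩
  · have : 0 ≤ ∑ j ∈ Finset.range (i + 1), |C j| := Finset.sum_nonneg fun _ _ => abs_nonneg _
    linarith
  · have h1 : |C j| ≤ ∑ j ∈ Finset.range (i + 1), |C j| :=
      Finset.single_le_sum (f := fun j => |C j|) (fun _ _ => abs_nonneg _)
        (Finset.mem_range.2 (by omega))
    linarith [hC j x hx, le_abs_self (C j)]

theorem IsSymbol.exists_push_bound (h : IsSymbol X ψ) (K : Compacts (Euc d))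
    (hKX : (K : Set (Euc d)) ⊆ X) (i : ℕ) :
    ∃ (s : Finset ℕ) (C : ℝ), 0 ≤ C ∧ ∀ φ : 𝓓_{K}(Euc d, ℂ), ∀ y ∈ ψ '' (K : Set (Euc d)),
      ‖iteratedFDeriv ℝ i (pushFun X ψ φ) y‖ ≤
        C * (s.sup fun j => ContDiffMapSupportedIn.seminorm ℂ (Euc d) ℂ ⊤ K j) φ := by
  have hcomp := h.isCompact_image K.isCompact hKX
  have hsub := h.image_subset hKX
  obtain ⟨A, hA1, hA⟩ := exists_bound h.contDiffOn_weight hcomp hsub i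
  obtain ⟨D, hD1, hD⟩ := exists_bound h.contDiffOn_inv hcomp hsub i
  refine ⟨Finset.range (i + 1), ∑ j ∈ Finset.range (i + 1),
    (i.choose j : ℝ) * A * ((i - j).factorial * D ^ (i - j)), ?_, fun φ y hy => ?_⟩
  · exact Finset.sum_nonneg fun j _ => by positivity
  set S : ℝ := ((Finset.range (i + 1)).sup
    fun j => ContDiffMapSupportedIn.seminorm ℂ (Euc d) ℂ ⊤ K j) φ with hS
  have hyX : y ∈ (X : Set (Euc d)) := hsub hy
  have hφ : ContDiff ℝ ∞ (φ : Euc d → ℂ) := φ.contDiff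
  have hS0 : 0 ≤ S := apply_nonneg _ _
  have hφS : ∀ j ≤ i, ∀ x, ‖iteratedFDeriv ℝ j φ x‖ ≤ S := by
    intro j hj x
    refine (ContDiffMapSupportedIn.norm_iteratedFDeriv_apply_le_seminorm_top ℂ).trans ?_
    have hle := Finset.le_sup (f := fun j => ContDiffMapSupportedIn.seminorm ℂ (Euc d) ℂ ⊤ K j)
      (Finset.mem_range.2 (Nat.lt_succ_of_le hj))
    exact hle φ
  have heq : iteratedFDeriv ℝ i (pushFun X ψ φ) y =
      iteratedFDerivWithin ℝ i (fun y => weight X ψ y • (φ ∘ invSymbol X ψ) y) X y := by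
    rw [← iteratedFDerivWithin_of_isOpen i X.isOpen hyX]
    exact iteratedFDerivWithin_congr (fun z hz => pushFun_of_mem hz) hyX i
  rw [heq, Finset.sum_mul]
  refine (norm_iteratedFDerivWithin_smul_le (N := ∞) h.contDiffOn_weight
    (hφ.comp_contDiffOn h.contDiffOn_inv) X.isOpen.uniqueDiffOn hyX
    (by exact_mod_cast le_top)).trans (Finset.sum_le_sum fun j hj => ?_)
  have hji : j ≤ i := Nat.lt_succ_iff.1 (Finset.mem_range.1 hj)
  have hc : ‖iteratedFDerivWithin ℝ (i - j) (φ ∘ invSymbol X ψ) X y‖ ≤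
      (i - j).factorial * S * D ^ (i - j) := by
    refine norm_iteratedFDerivWithin_comp_le (N := ∞) (t := univ) hφ.contDiffOn
      h.contDiffOn_inv (WithTop.coe_le_coe.2 le_top) uniqueDiffOn_univ X.isOpen.uniqueDiffOn
      (mapsTo_univ _ _) hyX (fun k hk => ?_) (fun k hk1 hk => ?_)
    · rw [iteratedFDerivWithin_univ]
      exact hφS k (by omega) _
    · exact (hD k (by omega) y hy).trans (le_self_pow₀ hD1 (by omega))
  calc (i.choose j : ℝ) * ‖iteratedFDerivWithin ℝ j (weight X ψ) X y‖ *
        ‖iteratedFDerivWithin ℝ (i - j) (φ ∘ invSymbol X ψ) X y‖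
      ≤ (i.choose j : ℝ) * A * ((i - j).factorial * S * D ^ (i - j)) := by
        gcongr
        exact hA j hji y hy
    _ = (i.choose j : ℝ) * A * ((i - j).factorial * D ^ (i - j)) * S := by ring

end Aux

section Operator

variable {d : ℕ} {X : Opens (Euc d)} {ψ : Euc d → Euc d}

/-- `φ ↦ (φ / |det Jψ|) ∘ ψ⁻¹` from `𝓓(K)` to `𝓓(ψ(K))`. -/
noncomputable def pushSupported (h : IsSymbol X ψ) (K : Compacts (Euc d))
    (hKX : (K : Set (Euc d)) ⊆ X) :
    𝓓_{K}(Euc d, ℂ) →L[ℂ]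
      𝓓_{(⟨ψ '' K, h.isCompact_image K.isCompact hKX⟩ : Compacts (Euc d))}(Euc d, ℂ) :=
  ContDiffMapSupportedIn.mkCLM ℂ (fun φ => pushFun X ψ φ)
    (fun f g x => by
      by_cases hx : x ∈ X
      · simp [pushFun_of_mem hx]
      · simp [pushFun, hx])
    (fun c f x => by
      by_cases hx : x ∈ X
      · simp [pushFun_of_mem hx, mul_left_comm]
      · simp [pushFun, hx])
    (fun f => h.contDiff_pushFun K.isCompact hKX f.contDiff f.support_subset)
    (fun f y hy => by
      by_contra hne
      exact hy (h.support_pushFun f.support_subset hne))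
    (fun i _ => h.exists_push_bound K hKX i)

/-- The continuous operator `φ ↦ (φ / |det Jψ|) ∘ ψ⁻¹` on the space of test functions `𝓓(X)`. -/
noncomputable def pushTest (h : IsSymbol X ψ) : 𝓓(X, ℂ) →L[ℂ] 𝓓(X, ℂ) :=
  TestFunction.limitCLM ℂ
    (fun φ => ⟨pushFun X ψ φ,
      h.contDiff_pushFun φ.hasCompactSupport φ.tsupport_subset φ.contDiff (subset_tsupport _),
      HasCompactSupport.of_support_subset_isCompact
        (h.isCompact_image φ.hasCompactSupport φ.tsupport_subset)
        (h.support_pushFun (subset_tsupport _)),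
      (closure_minimal (h.support_pushFun (subset_tsupport _))
        (h.isCompact_image φ.hasCompactSupport φ.tsupport_subset).isClosed).trans
        (h.image_subset φ.tsupport_subset)⟩)
    (fun K hKX => TestFunction.ofSupportedInCLM ℂ (h.image_subset hKX) ∘L
      pushSupported h K hKX)
    (fun _ _ _ => rfl)

theorem pushTest_apply (h : IsSymbol X ψ) (φ : 𝓓(X, ℂ)) (y : Euc d) :
    pushTest h φ y = pushFun X ψ φ y := rfl

/-- The composition operator `C_ψ` on `𝓓'(X)` for a smooth bijective symbol `ψ` with nowhere
vanishing Jacobian determinant: `⟨C_ψ u, φ⟩ = ⟨u, (φ / |det Jψ|) ∘ ψ⁻¹⟩`. By `compOp_ofFun` below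
it is the continuous extension to `𝓓'(X)` of `f ↦ f ∘ ψ` on `C(X)`. -/
noncomputable def compOp (h : IsSymbol X ψ) : Distr X →L[ℂ] Distr X :=
  ContinuousLinearMap.precomp ℂ (pushTest h)

theorem compOp_apply (h : IsSymbol X ψ) (u : Distr X) (φ : 𝓓(X, ℂ)) :
    compOp h u φ = u (pushTest h φ) := rfl

/-- The distribution `φ ↦ ∫ φ f` defined by a locally integrable function `f` on `X`. -/
noncomputable def ofFun (X : Opens (Euc d)) (f : Euc d → ℂ) : Distr X :=
  TestFunction.integralAgainstBilinCLM (ContinuousLinearMap.mul ℂ ℂ) volume f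

theorem ofFun_apply {f : Euc d → ℂ} (hf : ContinuousOn f X) (φ : 𝓓(X, ℂ)) :
    ofFun X f φ = ∫ x in (X : Set (Euc d)), φ x * f x := by
  have hl : LocallyIntegrableOn f X (volume : Measure (Euc d)) :=
    hf.locallyIntegrableOn X.isOpen.measurableSet
  rw [ofFun, TestFunction.integralAgainstBilinCLM_eq_integral hl,
    setIntegral_eq_integral_of_forall_compl_eq_zero]
  · rfl
  · intro x hx
    have : φ x = 0 := image_eq_zero_of_notMem_tsupport fun hx' => hx (φ.tsupport_subset hx')
    simp [this]

/-- `C_ψ` extends the composition operator on continuous functions. -/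
theorem compOp_ofFun (h : IsSymbol X ψ) {f : Euc d → ℂ} (hf : ContinuousOn f X) :
    compOp h (ofFun X f) = ofFun X (f ∘ ψ) := by
  ext φ
  rw [compOp_apply, ofFun_apply hf,
    ofFun_apply (hf.comp h.smooth.continuousOn h.bij.mapsTo)]
  have key := integral_image_eq_integral_abs_det_fderiv_smul volume X.isOpen.measurableSet
    (fun x hx => ((h.contDiffAt hx).differentiableAt (by simp)).hasFDerivAt.hasFDerivWithinAt)
    h.bij.injOn (fun y => pushTest h φ y * f y)
  rw [h.bij.image_eq] at key
  rw [key]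
  refine setIntegral_congr_fun X.isOpen.measurableSet fun x hx => ?_
  have hd : |(fderiv ℝ ψ x).det| ≠ 0 := abs_ne_zero.2 (h.det_ne x hx)
  have hp : pushTest h φ (ψ x) = |(fderiv ℝ ψ x).det|⁻¹ • φ x := by
    rw [pushTest_apply, pushFun_of_mem (h.bij.mapsTo hx), weight, h.inv_apply hx]
  simp only [hp, Function.comp_apply]
  rw [← smul_mul_assoc, smul_smul, mul_inv_cancel₀ hd, one_smul]

end Operator

end CompositionOp

/-!
Write `T φ = (φ / |det Jψ|) ∘ ψ⁻¹`, so that `C_ψ` is the transpose of `T` on `𝓓(X)`.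

If (ii) holds, then the powers of `T` are equicontinuous on `𝓓(X)`: stable orbits confine the
supports of `T^m φ`, `φ ∈ 𝓓(K)`, to one compact set, and the bounds on `(ψ⁻ᵐ)_c` bound their
derivatives. Hence the union of the images of a bounded set under all `T^m` is bounded, and taking
polars gives power boundedness of the transpose for the strong dual topology.

Conversely, if `C_ψ` is power bounded, then the orbit of each test function `φ` lies in the bipolar
of a bounded subset of `𝓓(X)`. So the `T^m φ` have their supports in a common compact set, which
gives stable orbits, and all their derivatives are uniformly bounded. Since
`T^m (x_c φ) = (ψ⁻ᵐ)_c · T^m φ`, the component `(ψ⁻ᵐ)_c` is the quotient of two functions with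
bounded derivatives, and it remains to bound `T^m φ` from below on `ψᵐ(K)`, where `φ = 1` on a
compact set containing the orbits of the points of `K`. By Arzelà–Ascoli some `T^a φ` and `T^b φ`
with `b - a` large are uniformly close; as `T` preserves the `L¹` norm, `T^(b-a) φ` is close to `φ`
in `L¹` and, having a uniform Lipschitz bound, also uniformly. Thus `|det Jψⁿ| ≤ 2` on `K` for
arbitrarily large `n`, and the chain rule turns this into an upper bound for `|det Jψᵐ|`, `m ≤ n`.
-/

namespace CompositionOp

section StrongDual

variable {𝕜 E F : Type*} [RCLike 𝕜] [AddCommGroup E] [Module 𝕜 E] [TopologicalSpace E]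
  [NormedAddCommGroup F] [NormedSpace 𝕜 F]

theorem exists_isVonNBounded_forall_le [ContinuousConstSMul 𝕜 E] {q : Seminorm 𝕜 (E →L[𝕜] F)}
    (hq : Continuous q) :
    ∃ B : Set E, Bornology.IsVonNBounded 𝕜 B ∧
      ∀ (u : E →L[𝕜] F) (C : ℝ), 0 ≤ C → (∀ x ∈ B, ‖u x‖ ≤ C) → q u ≤ C := by
  have hU : {u : E →L[𝕜] F | q u < 1} ∈ 𝓝 0 := (isOpen_lt hq continuous_const).mem_nhds (by simp)
  obtain ⟨⟨B, ε⟩, ⟨hB, hε : 0 < ε⟩, hsub⟩ := (ContinuousLinearMap.hasBasis_nhds_zero_of_basis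
    (E := E) (σ := RingHom.id 𝕜) (Metric.nhds_basis_ball (x := (0 : F)))).mem_iff.1 hU
  have hB' := hB.image (((ε⁻¹ : ℝ) : 𝕜) • ContinuousLinearMap.id 𝕜 E)
  refine ⟨_, hB', fun u C hC hu => le_of_forall_gt_imp_ge_of_dense fun C' hC' => ?_⟩
  have hC'0 : 0 < C' := hC.trans_lt hC'
  have hlt : q (((C'⁻¹ : ℝ) : 𝕜) • u) < 1 := by
    refine hsub fun x hx => mem_ball_zero_iff.2 ?_
    have hx' : ε⁻¹ * ‖u x‖ ≤ C := by
      simpa [norm_smul, abs_of_pos hε] using hu _ (mem_image_of_mem _ hx)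
    calc ‖(((C'⁻¹ : ℝ) : 𝕜) • u) x‖ = C'⁻¹ * ε * (ε⁻¹ * ‖u x‖) := by
          rw [smul_apply, norm_smul, RCLike.norm_ofReal, abs_of_pos (inv_pos.2 hC'0)]
          field_simp
      _ ≤ C'⁻¹ * ε * C := by gcongr
      _ < C'⁻¹ * ε * C' := by gcongr
      _ = ε := by field_simp
  rw [map_smul_eq_mul, RCLike.norm_ofReal, abs_of_pos (inv_pos.2 hC'0),
    inv_mul_lt_iff₀ hC'0, mul_one] at hlt
  exact hlt.le

theorem exists_continuous_seminorm_of_isVonNBounded {B : Set E}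
    (hB : Bornology.IsVonNBounded 𝕜 B) :
    ∃ q : Seminorm 𝕜 (E →L[𝕜] F), Continuous q ∧ ∀ u, ∀ x ∈ B, ‖u x‖ ≤ q u := by
  let p (x : B) : Seminorm 𝕜 (E →L[𝕜] F) :=
    (normSeminorm 𝕜 F).comp (LinearMap.applyₗ x.1 ∘ₗ ContinuousLinearMap.coeLM 𝕜)
  have hU : ∀ᶠ u : E →L[𝕜] F in 𝓝 0, ∀ x : B, p x u ≤ 1 := by
    filter_upwards [ContinuousLinearMap.eventually_nhds_zero_mapsTo (σ := RingHom.id 𝕜) hB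
      (Metric.closedBall_mem_nhds (0 : F) one_pos)] with u hu x
    exact mem_closedBall_zero_iff.1 (hu x.2)
  have hbdd : BddAbove (range p) := Seminorm.bddAbove_of_absorbent (absorbent_nhds_zero hU)
    fun u hu => ⟨1, forall_mem_range.2 hu⟩
  refine ⟨⨆ x, p x, Seminorm.continuous' (r := 1) ?_, fun u x hx => ?_⟩
  · filter_upwards [hU] with u hu
    simpa only [Seminorm.closedBall_iSup hbdd _ one_pos, mem_iInter, Seminorm.mem_closedBall_zero]
      using hu
  · rw [Seminorm.iSup_apply hbdd]
    exact le_ciSup (Seminorm.bddAbove_range_iff.1 hbdd u) (⟨x, hx⟩ : B)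

theorem precomp_pow_apply (T : E →L[𝕜] E) (m : ℕ) (u : E →L[𝕜] F) (x : E) :
    (ContinuousLinearMap.precomp F T ^ m) u x = u ((T ^ m) x) := by
  induction m generalizing u with
  | zero => rfl
  | succ m ih =>
    rw [pow_succ, pow_succ']
    exact ih _

theorem isVonNBounded_iUnion_image_of_equicontinuous {ι E' : Type*} [AddCommGroup E']
    [Module 𝕜 E'] [TopologicalSpace E'] {T : ι → E →L[𝕜] E'}
    (hT : ∀ V ∈ 𝓝 (0 : E'), ∀ᶠ x in 𝓝 0, ∀ i, T i x ∈ V) {B : Set E}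
    (hB : Bornology.IsVonNBounded 𝕜 B) : Bornology.IsVonNBounded 𝕜 (⋃ i, T i '' B) := by
  intro V hV
  filter_upwards [hB (hT V hV)] with a ha
  refine iUnion_subset fun i => image_subset_iff.2 fun x hx => ?_
  obtain ⟨y, hy, rfl⟩ := ha hx
  exact ⟨T i y, hy i, (map_smul (T i) a y).symm⟩

end StrongDual

section Transpose

variable {E F : Type*} [AddCommGroup E] [Module ℂ E] [TopologicalSpace E]
  [NormedAddCommGroup F] [NormedSpace ℂ F] {T : E →L[ℂ] E}

theorem powerBounded_precomp [ContinuousConstSMul ℂ E]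
    (hT : ∀ B : Set E, Bornology.IsVonNBounded ℂ B →
      Bornology.IsVonNBounded ℂ (⋃ m : ℕ, (T ^ m) '' B)) :
    PowerBounded (E := E →L[ℂ] F) (ContinuousLinearMap.precomp F T) := by
  intro p hp
  obtain ⟨B, hB, hpB⟩ := exists_isVonNBounded_forall_le hp
  obtain ⟨q, hq, hqB⟩ := exists_continuous_seminorm_of_isVonNBounded (F := F) (hT B hB)
  refine ⟨q, hq, fun m u => hpB _ _ (apply_nonneg q u) fun x hx => ?_⟩
  rw [precomp_pow_apply]
  exact hqB u _ (mem_iUnion.2 ⟨m, mem_image_of_mem _ hx⟩)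

/-- In other words, the orbit of `x` lies in the bipolar of `B`. -/
theorem PowerBounded.exists_isVonNBounded_forall_norm_le [ContinuousSMul ℂ E]
    (hT : PowerBounded (E := E →L[ℂ] F) (ContinuousLinearMap.precomp F T)) (x : E) :
    ∃ B : Set E, Bornology.IsVonNBounded ℂ B ∧ ∀ (u : E →L[ℂ] F) (C : ℝ), 0 ≤ C →
      (∀ y ∈ B, ‖u y‖ ≤ C) → ∀ m : ℕ, ‖u ((T ^ m) x)‖ ≤ C := by
  obtain ⟨p, hp, hpx⟩ := exists_continuous_seminorm_of_isVonNBounded (F := F)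
    (Bornology.isVonNBounded_singleton (𝕜 := ℂ) x)
  obtain ⟨q, hq, hpq⟩ := hT p hp
  obtain ⟨B, hB, hqB⟩ := exists_isVonNBounded_forall_le hq
  refine ⟨B, hB, fun u C hC hu m => ?_⟩
  calc ‖u ((T ^ m) x)‖ ≤ p ((ContinuousLinearMap.precomp F T ^ m) u) := by
        rw [← precomp_pow_apply]
        exact hpx _ _ rfl
    _ ≤ q u := hpq m u
    _ ≤ C := hqB u C hC hu

end Transpose

section TestFunctionSpace

variable {𝕜 E F : Type*} [RCLike 𝕜] [NormedAddCommGroup E] [NormedSpace ℝ E]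
  [NormedAddCommGroup F] [NormedSpace ℝ F] [NormedSpace 𝕜 F] [IsScalarTower ℝ 𝕜 F]
  {Ω : Opens E} {n : ℕ∞}

instance instContinuousSMulTestFunction : ContinuousSMul 𝕜 𝓓^{n}(Ω, F) := by
  refine ⟨?_⟩
  let smulI : 𝓓^{n}(Ω, F) →L[ℝ] 𝓓^{n}(Ω, F) :=
    TestFunction.mkCLM ℝ (fun φ => (RCLike.I : 𝕜) • φ) (fun _ _ => smul_add _ _ _)
      (fun _ _ => smul_comm _ _ _) fun _ hK =>
        (TestFunction.continuous_ofSupportedIn hK).comp (continuous_const_smul (RCLike.I : 𝕜))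
  have hsmul : (fun p : 𝕜 × 𝓓^{n}(Ω, F) => p.1 • p.2) =
      fun p => RCLike.re p.1 • p.2 + RCLike.im p.1 • smulI p.2 := by
    funext ⟨c, φ⟩
    ext x
    change c • φ x = RCLike.re c • φ x + RCLike.im c • (RCLike.I : 𝕜) • φ x
    rw [← algebraMap_smul 𝕜 (RCLike.re c), ← algebraMap_smul 𝕜 (RCLike.im c), smul_smul, ← add_smul]
    exact congrArg (· • φ x) (RCLike.re_add_im c).symm
  rw [hsmul]
  exact ((RCLike.continuous_re.comp continuous_fst).smul continuous_snd).add
    ((RCLike.continuous_im.comp continuous_fst).smul (smulI.continuous.comp continuous_snd))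

end TestFunctionSpace

section BoundedSets

variable {E F : Type*} [NormedAddCommGroup E] [NormedSpace ℝ E] [NormedAddCommGroup F]
  [NormedSpace ℝ F] {Ω : Opens E} {n : ℕ∞}

theorem continuous_seminorm_comp_linearMap {V : Type*} [AddCommGroup V] [Module ℝ V]
    (R : Seminorm ℝ V) (L : 𝓓^{n}(Ω, F) →ₗ[ℝ] V)
    (hR : ∀ (K : Compacts E) (hK : (K : Set E) ⊆ Ω),
      Continuous fun φ : 𝓓^{n}_{K}(E, F) => R (L (TestFunction.ofSupportedIn hK φ))) :
    Continuous fun φ => R (L φ) := by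
  let p : SeminormFamily ℝ V Unit := fun _ => R
  let : TopologicalSpace V := p.moduleFilterBasis.topology
  have hp : WithSeminorms p := ⟨rfl⟩
  have := hp.topologicalAddGroup
  have := hp.continuousSMul
  have := hp.toLocallyConvexSpace
  have hL : Continuous L := (TestFunction.continuous_iff_continuous_comp L).2 fun K hK =>
    (WithSeminorms.continuous_iff_continuous_comp hp
      (L ∘ₗ (TestFunction.ofSupportedInCLM ℝ hK).toLinearMap)).2 fun _ => hR K hK
  exact (hp.continuous_seminorm ()).comp hL

theorem exists_continuous_seminorm_forall_le {ι : Type*} (r : ι → Seminorm ℝ 𝓓^{n}(Ω, F))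
    (hr : ∀ (K : Compacts E) (hK : (K : Set E) ⊆ Ω), ∃ P : Seminorm ℝ 𝓓^{n}_{K}(E, F),
      Continuous P ∧ ∀ i φ, r i (TestFunction.ofSupportedIn hK φ) ≤ P φ) :
    ∃ R : Seminorm ℝ 𝓓^{n}(Ω, F), Continuous R ∧ ∀ i, r i ≤ R := by
  have hbdd : BddAbove (range r) := by
    refine Seminorm.bddAbove_range_iff.2 fun φ => ?_
    obtain ⟨P, -, hP⟩ := hr ⟨tsupport φ, φ.hasCompactSupport⟩ φ.tsupport_subset
    exact ⟨_, forall_mem_range.2 fun i => hP i (.of_support_subset φ.contDiff (subset_tsupport φ))⟩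
  refine ⟨⨆ i, r i, continuous_seminorm_comp_linearMap _ LinearMap.id fun K hK => ?_,
    fun i φ => (le_ciSup (Seminorm.bddAbove_range_iff.1 hbdd φ) i).trans_eq
      (Seminorm.iSup_apply hbdd).symm⟩
  obtain ⟨P, hP, hrP⟩ := hr K hK
  refine Seminorm.continuous_of_le
    (p := (⨆ i, r i).comp (TestFunction.ofSupportedInCLM ℝ hK).toLinearMap) hP fun φ => ?_
  exact (Seminorm.iSup_apply hbdd).trans_le (Real.iSup_le (hrP · φ) (apply_nonneg P φ))

theorem exists_forall_seminorm_le_of_isVonNBounded {ι : Type*} (r : ι → Seminorm ℝ 𝓓^{n}(Ω, F))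
    (hr : ∀ (K : Compacts E) (hK : (K : Set E) ⊆ Ω), ∃ P : Seminorm ℝ 𝓓^{n}_{K}(E, F),
      Continuous P ∧ ∀ i φ, r i (TestFunction.ofSupportedIn hK φ) ≤ P φ)
    {B : Set 𝓓^{n}(Ω, F)} (hB : Bornology.IsVonNBounded ℝ B) :
    ∃ M : ℝ, ∀ i, ∀ φ ∈ B, r i φ ≤ M := by
  obtain ⟨R, hR, hrR⟩ := exists_continuous_seminorm_forall_le r hr
  obtain ⟨M, -, hM⟩ := (PolynormableSpace.withSeminorms ℝ
    𝓓^{n}(Ω, F)).isVonNBounded_iff_seminorm_bounded.1 hB ⟨R, hR⟩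
  exact ⟨M, fun i φ hφ => (hrR i φ).trans (hM φ hφ).le⟩

theorem exists_forall_seminorm_le_of_locallyFinite {ι : Type*}
    {r : ι → Seminorm ℝ 𝓓^{n}(Ω, F)} (hr : ∀ i, Continuous (r i))
    (hfin : ∀ (K : Compacts E) (hK : (K : Set E) ⊆ Ω), ∀ᶠ i in cofinite,
      ∀ φ : 𝓓^{n}_{K}(E, F), r i (TestFunction.ofSupportedIn hK φ) = 0)
    {B : Set 𝓓^{n}(Ω, F)} (hB : Bornology.IsVonNBounded ℝ B) :
    ∃ M : ℝ, ∀ i, ∀ φ ∈ B, r i φ ≤ M := by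
  refine exists_forall_seminorm_le_of_isVonNBounded r (fun K hK => ?_) hB
  set s := (eventually_cofinite.1 (hfin K hK)).toFinset
  let p (i : ι) : Seminorm ℝ 𝓓^{n}_{K}(E, F) :=
    (r i).comp (TestFunction.ofSupportedInCLM ℝ hK).toLinearMap
  refine ⟨s.sup p, Seminorm.continuous_finsetSup fun i _ =>
    (hr i).comp (TestFunction.continuous_ofSupportedIn hK), fun i φ => ?_⟩
  by_cases hi : r i (TestFunction.ofSupportedIn hK φ) = 0
  · exact hi.trans_le (apply_nonneg _ φ)
  · exact Seminorm.le_finset_sup_apply (p := p)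
      ((Set.Finite.mem_toFinset _).2 fun h => hi (h φ))

end BoundedSets

section Derivatives

variable (𝕜 : Type*) {E F : Type*} [RCLike 𝕜] [NormedAddCommGroup E] [NormedSpace ℝ E]
  [NormedAddCommGroup F] [NormedSpace ℝ F] [NormedSpace 𝕜 F] [IsScalarTower ℝ 𝕜 F]
  (Ω : Opens E) (i : ℕ) (x : E)

/-- The derivative of order `i` at `x`, as a continuous linear map on the test functions. -/
noncomputable def iteratedFDerivAt : 𝓓(Ω, F) →L[𝕜] E [×i]→L[ℝ] F :=
  TestFunction.mkCLM 𝕜 (fun φ => iteratedFDeriv ℝ i φ x)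
    (fun φ χ => iteratedFDeriv_add_apply (φ.contDiff.contDiffAt.of_le (mod_cast le_top))
      (χ.contDiff.contDiffAt.of_le (mod_cast le_top)))
    (fun c φ => iteratedFDeriv_const_smul_apply (φ.contDiff.contDiffAt.of_le (mod_cast le_top)))
    (fun K hK => by
      have hcont : Continuous fun φ : 𝓓_{K}(E, F) =>
          ContDiffMapSupportedIn.structureMapCLM 𝕜 ⊤ i φ x :=
        (continuous_eval_const x).comp (ContDiffMapSupportedIn.structureMapCLM 𝕜 ⊤ i).continuous
      refine hcont.congr fun φ => ?_
      rw [ContDiffMapSupportedIn.structureMapCLM_top_apply]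
      rfl)

/-- The directional derivative `φ ↦ D^i φ(x)(v₁, …, v_i)`; this is a distribution if `F = 𝕜`. -/
noncomputable def directionalDerivAt (v : Fin i → E) : 𝓓(Ω, F) →L[𝕜] F where
  toFun φ := iteratedFDerivAt 𝕜 Ω i x φ v
  map_add' φ χ := by rw [map_add]; rfl
  map_smul' c φ := by rw [map_smul]; rfl
  cont := (continuous_eval_const v).comp (iteratedFDerivAt 𝕜 Ω i x).continuous

variable {𝕜 Ω i x}

theorem exists_norm_iteratedFDeriv_le_of_isVonNBounded (i : ℕ) {B : Set 𝓓(Ω, F)}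
    (hB : Bornology.IsVonNBounded 𝕜 B) :
    ∃ M : ℝ, 0 ≤ M ∧ ∀ φ ∈ B, ∀ x, ‖iteratedFDeriv ℝ i φ x‖ ≤ M := by
  let r (x : E) : Seminorm ℝ 𝓓(Ω, F) :=
    (normSeminorm ℝ (E [×i]→L[ℝ] F)).comp (iteratedFDerivAt ℝ Ω i x).toLinearMap
  obtain ⟨M, hM⟩ := exists_forall_seminorm_le_of_isVonNBounded r (fun K hK =>
    ⟨ContDiffMapSupportedIn.seminorm ℝ E F ⊤ K i,
      (ContDiffMapSupportedIn.withSeminorms ℝ E F ⊤ K).continuous_seminorm i, fun x φ =>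
        ContDiffMapSupportedIn.norm_iteratedFDeriv_apply_le_seminorm_top ℝ⟩)
    (hB.restrict_scalars ℝ)
  exact ⟨max M 0, le_max_right _ _, fun φ hφ x => (hM x φ hφ).trans (le_max_left _ _)⟩

end Derivatives

section Support

variable {𝕜 E F : Type*} [RCLike 𝕜] [NormedAddCommGroup E] [NormedSpace ℝ E]
  [NormedAddCommGroup F] [NormedSpace ℝ F] [NormedSpace 𝕜 F] [IsScalarTower ℝ 𝕜 F]
  {Ω : Opens E}

theorem exists_compact_exhaustion_of_isOpen {α : Type*} [TopologicalSpace α]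
    [LocallyCompactSpace α] [SecondCountableTopology α] {U : Set α} (hU : IsOpen U) :
    ∃ K : ℕ → Set α, (∀ j, IsCompact (K j)) ∧ (∀ j, K j ⊆ U) ∧
      ∀ L ⊆ U, IsCompact L → ∃ n, ∀ j ≥ n, L ⊆ K j := by
  have : LocallyCompactSpace U := hU.locallyCompactSpace
  let e : CompactExhaustion U := CompactExhaustion.choice U
  refine ⟨fun j => Subtype.val '' e j, fun j => (e.isCompact j).image continuous_subtype_val,
    fun j => Subtype.coe_image_subset U _, fun L hLU hL => ?_⟩
  have hL' : IsCompact (Subtype.val ⁻¹' L : Set U) :=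
    Topology.IsInducing.subtypeVal.isCompact_preimage' hL (by rwa [Subtype.range_coe])
  obtain ⟨n, hn⟩ := e.exists_superset_of_isCompact hL'
  exact ⟨n, fun j hj x hx => ⟨⟨x, hLU hx⟩, e.subset hj (hn hx), rfl⟩⟩

/-- If the supports escape along points `y j` with `φ j (y j) ≠ 0`, then
`χ ↦ sup_j (j / ‖φ j (y j)‖) ‖χ (y j)‖` is a continuous seminorm which is unbounded on `B`. -/
theorem exists_isCompact_support_subset_of_isVonNBounded [ProperSpace E] {B : Set 𝓓(Ω, F)}
    (hB : Bornology.IsVonNBounded 𝕜 B) :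
    ∃ L ⊆ (Ω : Set E), IsCompact L ∧ ∀ φ ∈ B, Function.support φ ⊆ L := by
  obtain ⟨K, hK, hKΩ, hKL⟩ := exists_compact_exhaustion_of_isOpen Ω.isOpen
  by_contra! hcon
  have hescape : ∀ j, ∃ φ ∈ B, ∃ y ∉ K j, φ y ≠ 0 := fun j => by
    obtain ⟨φ, hφ, hφK⟩ := hcon (K j) (hKΩ j) (hK j)
    obtain ⟨y, hy, hyK⟩ := not_subset.1 hφK
    exact ⟨φ, hφ, y, hyK, hy⟩
  choose φ hφB y hyK hφy using hescape
  let r (j : ℕ) : Seminorm ℝ 𝓓(Ω, F) := ((j : NNReal) / ‖φ j (y j)‖₊) • (normSeminorm ℝ F).comp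
    (BoundedContinuousFunction.evalCLM ℝ (y j) ∘L
      TestFunction.toBoundedContinuousFunctionCLM ℝ).toLinearMap
  have hr : ∀ j χ, r j χ = j / ‖φ j (y j)‖ * ‖χ (y j)‖ := fun _ _ => rfl
  have hr_cont : ∀ j, Continuous (r j) := fun j =>
    (continuous_const.mul (continuous_eval_const (y j)).norm : Continuous fun χ : 𝓓(Ω, F) =>
      (j / ‖φ j (y j)‖ : ℝ) * ‖χ (y j)‖)
  obtain ⟨M, hM⟩ := exists_forall_seminorm_le_of_locallyFinite hr_cont (fun L hL => by
    obtain ⟨n, hn⟩ := hKL L hL L.isCompact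
    rw [Nat.cofinite_eq_atTop]
    filter_upwards [eventually_ge_atTop n] with j hj χ
    have hzero : TestFunction.ofSupportedIn hL χ (y j) = 0 :=
      χ.zero_on_compl fun hy => hyK j (hn j hj hy)
    rw [hr, hzero, norm_zero, mul_zero]) (hB.restrict_scalars ℝ)
  obtain ⟨j, hj⟩ := exists_nat_gt M
  refine hj.not_ge ((hM j _ (hφB j)).trans' ?_)
  rw [hr, div_mul_cancel₀ _ (norm_ne_zero_iff.2 (hφy j))]

open scoped Manifold in
theorem exists_testFunction_eqOn_const [FiniteDimensional ℝ E] {K : Set E} (hK : IsCompact K)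
    (hKΩ : K ⊆ Ω) (c : F) : ∃ φ : 𝓓(Ω, F), ∀ x ∈ K, φ x = c := by
  obtain ⟨L, hL, hKL, hLΩ⟩ := exists_compact_between hK Ω.isOpen hKΩ
  obtain ⟨f, hf1, hf0, -⟩ := exists_contMDiffMap_one_nhds_of_subset_interior (n := ⊤)
    𝓘(ℝ, E) hK.isClosed hKL
  have hsupp : Function.support (fun x => f x • c) ⊆ L := fun x hx => by
    by_contra hxL
    exact hx (by simp [hf0 x hxL])
  refine ⟨⟨fun x => f x • c, f.contMDiff.contDiff.smul contDiff_const,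
    HasCompactSupport.of_support_subset_isCompact hL hsupp,
    (closure_minimal hsupp hL.isClosed).trans hLΩ⟩, fun x hx => ?_⟩
  change f x • c = c
  rw [hf1.self_of_nhdsSet x hx, one_smul]

end Support

section Calculus

variable {𝕜 : Type*} [NontriviallyNormedField 𝕜]
  {E : Type*} [NormedAddCommGroup E] [NormedSpace 𝕜 E]
  {V : Type*} [NormedAddCommGroup V] [NormedSpace 𝕜 V]
  {F : Type*} [NormedAddCommGroup F] [NormedSpace 𝕜 F]

theorem norm_iteratedFDeriv_comp_le_of_contDiffAt {g : V → F} {f : E → V} {x : E} {n : ℕ}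
    (hg : ContDiffAt 𝕜 n g (f x)) (hf : ContDiffAt 𝕜 n f x) {C D : ℝ}
    (hC : ∀ k ≤ n, ‖iteratedFDeriv 𝕜 k g (f x)‖ ≤ C)
    (hD : ∀ k, 1 ≤ k → k ≤ n → ‖iteratedFDeriv 𝕜 k f x‖ ≤ D ^ k) :
    ‖iteratedFDeriv 𝕜 n (g ∘ f) x‖ ≤ n.factorial * C * D ^ n := by
  obtain ⟨u, hu, hgu⟩ := hg.contDiffOn le_rfl (by simp)
  obtain ⟨s, hs, hfs⟩ := hf.contDiffOn le_rfl (by simp)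
  obtain ⟨t, htu, ht, hft⟩ := _root_.mem_nhds_iff.1 hu
  obtain ⟨v, hv, hvo, hxv⟩ :=
    _root_.mem_nhds_iff.1 (inter_mem hs (hf.continuousAt (ht.mem_nhds hft)))
  have hfv : ContDiffOn 𝕜 n f v := hfs.mono (hv.trans inter_subset_left)
  rw [← iteratedFDerivWithin_of_isOpen n hvo hxv]
  refine norm_iteratedFDerivWithin_comp_le (hgu.mono htu) hfv le_rfl ht.uniqueDiffOn
    hvo.uniqueDiffOn (fun y hy => (hv hy).2) hxv (fun k hk => ?_) fun k hk hkn => ?_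
  · rw [iteratedFDerivWithin_of_isOpen k ht hft]
    exact hC k hk
  · rw [iteratedFDerivWithin_of_isOpen k hvo hxv]
    exact hD k hk hkn

theorem norm_iteratedFDeriv_smul_le_of_contDiffAt {w : E → 𝕜} {f : E → F} {x : E} {n : ℕ}
    (hw : ContDiffAt 𝕜 n w x) (hf : ContDiffAt 𝕜 n f x) :
    ‖iteratedFDeriv 𝕜 n (fun y => w y • f y) x‖ ≤ ∑ i ∈ Finset.range (n + 1),
      (n.choose i : ℝ) * ‖iteratedFDeriv 𝕜 i w x‖ * ‖iteratedFDeriv 𝕜 (n - i) f x‖ := by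
  obtain ⟨u, hu, hwu⟩ := hw.contDiffOn le_rfl (by simp)
  obtain ⟨s, hs, hfs⟩ := hf.contDiffOn le_rfl (by simp)
  obtain ⟨v, hv, hvo, hxv⟩ := _root_.mem_nhds_iff.1 (inter_mem hu hs)
  have key := norm_iteratedFDerivWithin_smul_le (hwu.mono (hv.trans inter_subset_left))
    (hfs.mono (hv.trans inter_subset_right)) hvo.uniqueDiffOn hxv le_rfl
  simpa only [iteratedFDerivWithin_of_isOpen _ hvo hxv] using key

end Calculus

section RealCalculus

variable {E : Type*} [NormedAddCommGroup E] [NormedSpace ℝ E]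
  {V : Type*} [NormedAddCommGroup V] [NormedSpace ℝ V]
  {F : Type*} [NormedAddCommGroup F] [NormedSpace ℝ F]

theorem norm_iteratedFDeriv_smul_comp_le {w : E → ℝ} {f : E → V} {φ : V → F} {x : E} {n : ℕ}
    (hw : ContDiffAt ℝ n w x) (hf : ContDiffAt ℝ n f x) (hφ : ContDiffAt ℝ n φ (f x)) {A D S : ℝ}
    (hA : ∀ k ≤ n, ‖iteratedFDeriv ℝ k w x‖ ≤ A)
    (hD : ∀ k, 1 ≤ k → k ≤ n → ‖iteratedFDeriv ℝ k f x‖ ≤ D ^ k)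
    (hS : ∀ k ≤ n, ‖iteratedFDeriv ℝ k φ (f x)‖ ≤ S) :
    ‖iteratedFDeriv ℝ n (fun y => w y • φ (f y)) x‖ ≤
      (∑ k ∈ Finset.range (n + 1), (n.choose k : ℝ) * A * ((n - k).factorial * D ^ (n - k))) *
        S := by
  rw [Finset.sum_mul]
  refine (norm_iteratedFDeriv_smul_le_of_contDiffAt hw (hφ.comp x hf)).trans
    (Finset.sum_le_sum fun k hk => ?_)
  have hkn : k ≤ n := Nat.lt_succ_iff.1 (Finset.mem_range.1 hk)
  have hle : ((n - k : ℕ) : ℕ∞ω) ≤ n := by exact_mod_cast n.sub_le k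
  have hcomp : ‖iteratedFDeriv ℝ (n - k) (φ ∘ f) x‖ ≤ (n - k).factorial * S * D ^ (n - k) :=
    norm_iteratedFDeriv_comp_le_of_contDiffAt (hφ.of_le hle) (hf.of_le hle)
      (fun j hj => hS j (by omega)) fun j hj hjk => hD j hj (by omega)
  calc (n.choose k : ℝ) * ‖iteratedFDeriv ℝ k w x‖ * ‖iteratedFDeriv ℝ (n - k) (φ ∘ f) x‖
      ≤ (n.choose k : ℝ) * A * ((n - k).factorial * S * D ^ (n - k)) := by
        gcongr
        · exact mul_nonneg (Nat.cast_nonneg _) ((norm_nonneg _).trans (hA k hkn))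
        · exact hA k hkn
    _ = (n.choose k : ℝ) * A * ((n - k).factorial * D ^ (n - k)) * S := by ring

theorem exists_norm_iteratedFDeriv_le_of_isCompact {U K : Set V} {g : V → F} (hU : IsOpen U)
    (hg : ContDiffOn ℝ ∞ g U) (hK : IsCompact K) (hKU : K ⊆ U) (n : ℕ) :
    ∃ C, 0 ≤ C ∧ ∀ k ≤ n, ∀ x ∈ K, ‖iteratedFDeriv ℝ k g x‖ ≤ C := by
  have hbound (k : ℕ) : ∃ C, ∀ x ∈ K, ‖iteratedFDeriv ℝ k g x‖ ≤ C :=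
    hK.exists_bound_of_continuousOn <| ((hg.continuousOn_iteratedFDerivWithin
      (by exact_mod_cast le_top) hU.uniqueDiffOn).mono hKU).congr
        fun x hx => (iteratedFDerivWithin_of_isOpen k hU (hKU hx)).symm
  choose C hC using hbound
  refine ⟨∑ k ∈ Finset.range (n + 1), |C k|, Finset.sum_nonneg fun _ _ => abs_nonneg _,
    fun k hk x hx => (hC k x hx).trans ((le_abs_self _).trans ?_)⟩
  exact Finset.single_le_sum (f := fun k => |C k|) (fun _ _ => abs_nonneg _)
    (Finset.mem_range.2 (by omega))

theorem exists_norm_iteratedFDeriv_comp_le {U K : Set V} {g : V → F} (hU : IsOpen U)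
    (hg : ContDiffOn ℝ ∞ g U) (hK : IsCompact K) (hKU : K ⊆ U) (n : ℕ) (D : ℝ) :
    ∃ B, 0 ≤ B ∧ ∀ (f : E → V) (x : E), ContDiffAt ℝ n f x → f x ∈ K →
      (∀ k ≤ n, ‖iteratedFDeriv ℝ k f x‖ ≤ D) →
        ∀ k ≤ n, ‖iteratedFDeriv ℝ k (g ∘ f) x‖ ≤ B := by
  obtain ⟨C, hC0, hC⟩ := exists_norm_iteratedFDeriv_le_of_isCompact hU hg hK hKU n
  refine ⟨n.factorial * C * (max 1 D) ^ n, by positivity, fun f x hf hx hD k hk => ?_⟩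
  calc ‖iteratedFDeriv ℝ k (g ∘ f) x‖ ≤ k.factorial * C * (max 1 D) ^ k := by
        refine norm_iteratedFDeriv_comp_le_of_contDiffAt
          ((hg.contDiffAt (hU.mem_nhds (hKU hx))).of_le (by exact_mod_cast le_top))
          (hf.of_le (by exact_mod_cast hk)) (fun j hj => hC j (hj.trans hk) _ hx)
          fun j hj hjk => ?_
        exact (hD j (hjk.trans hk)).trans
          ((le_max_right 1 D).trans (le_self_pow₀ (le_max_left 1 D) (by omega)))
    _ ≤ n.factorial * C * (max 1 D) ^ n := by
        gcongr
        exact le_max_left _ _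

theorem norm_iteratedFDeriv_abs {f : E → ℝ} {x : E} (hf : ContinuousAt f x) (hx : f x ≠ 0)
    (k : ℕ) : ‖iteratedFDeriv ℝ k (fun y => |f y|) x‖ = ‖iteratedFDeriv ℝ k f x‖ := by
  rcases hx.lt_or_gt with hneg | hpos
  · have habs : (fun y => |f y|) =ᶠ[𝓝 x] -f := by
      filter_upwards [hf.eventually_lt_const hneg] with y hy using abs_of_neg hy
    rw [(habs.iteratedFDeriv ℝ k).eq_of_nhds, iteratedFDeriv_neg_apply, norm_neg]
  · have habs : (fun y => |f y|) =ᶠ[𝓝 x] f := by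
      filter_upwards [hf.eventually_const_lt hpos] with y hy using abs_of_pos hy
    rw [(habs.iteratedFDeriv ℝ k).eq_of_nhds]

end RealCalculus

section Coordinates

variable {ι : Type*} [Fintype ι]

theorem opNorm_le_of_orthonormalBasis {E F : Type*} [NormedAddCommGroup E] [InnerProductSpace ℝ E]
    [NormedAddCommGroup F] [NormedSpace ℝ F] (b : OrthonormalBasis ι ℝ E) {k : ℕ}
    (M : E [×k]→L[ℝ] F) {C : ℝ} (hC0 : 0 ≤ C)
    (hC : ∀ s : Fin k → ι, ‖M fun j => b (s j)‖ ≤ C) : ‖M‖ ≤ Fintype.card ι ^ k * C := by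
  refine M.opNorm_le_bound (by positivity) fun v => ?_
  calc ‖M v‖ = ‖∑ s : Fin k → ι, M fun j => b.repr (v j) (s j) • b (s j)‖ := by
        rw [← M.map_sum (g := fun j i => b.repr (v j) i • b i)]
        simp only [b.sum_repr]
    _ ≤ ∑ s : Fin k → ι, ‖M fun j => b.repr (v j) (s j) • b (s j)‖ := norm_sum_le _ _
    _ ≤ ∑ _s : Fin k → ι, (∏ j, ‖v j‖) * C := by
        refine Finset.sum_le_sum fun s _ => ?_
        rw [M.map_smul_univ (fun j => b.repr (v j) (s j)), norm_smul, norm_prod]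
        gcongr with j
        · exact (PiLp.norm_apply_le _ _).trans_eq (b.repr.norm_map _)
        · exact hC s
    _ = Fintype.card ι ^ k * C * ∏ j, ‖v j‖ := by
        rw [Finset.sum_const, Finset.card_univ, Fintype.card_fun, Fintype.card_fin, nsmul_eq_mul,
          Nat.cast_pow]
        ring

theorem norm_le_sum_norm_apply (v : EuclideanSpace ℝ ι) : ‖v‖ ≤ ∑ i, ‖v i‖ := by
  calc ‖v‖ = ‖∑ i, v i • EuclideanSpace.basisFun ι ℝ i‖ := by
        congr 1
        exact ((EuclideanSpace.basisFun ι ℝ).sum_repr v).symm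
    _ ≤ ∑ i, ‖v i‖ := (norm_sum_le _ _).trans_eq (by simp [norm_smul])

theorem norm_iteratedFDeriv_le_sum_coord {E : Type*} [NormedAddCommGroup E] [NormedSpace ℝ E]
    {g : E → EuclideanSpace ℝ ι} {x : E} {k : ℕ} (hg : ContDiffAt ℝ k g x) :
    ‖iteratedFDeriv ℝ k g x‖ ≤ ∑ i, ‖iteratedFDeriv ℝ k (fun y => g y i) x‖ := by
  refine ContinuousMultilinearMap.opNorm_le_bound
    (Finset.sum_nonneg fun _ _ => norm_nonneg _) fun v => ?_
  have hcoord (i : ι) : iteratedFDeriv ℝ k g x v i = iteratedFDeriv ℝ k (fun y => g y i) x v :=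
    (DFunLike.congr_fun ((EuclideanSpace.proj i : EuclideanSpace ℝ ι →L[ℝ] ℝ
      ).iteratedFDeriv_comp_left hg le_rfl) v).symm
  rw [Finset.sum_mul]
  refine (norm_le_sum_norm_apply _).trans (Finset.sum_le_sum fun i _ => ?_)
  rw [hcoord]
  exact ContinuousMultilinearMap.le_opNorm _ _

variable {d n k : ℕ} {K : Set (Euc d)} {f : Euc d → ℝ} {x : Euc d}

theorem norm_iteratedFDeriv_le_of_cnNorm_ne_top (h : cnNorm n K f ≠ ⊤) (hx : x ∈ K) (hk : k ≤ n) :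
    ‖iteratedFDeriv ℝ k f x‖ ≤ d ^ k * (cnNorm n K f).toReal := by
  have hpartial (s : Fin k → Fin d) :
      ‖iteratedFDeriv ℝ k f x fun j => EuclideanSpace.basisFun (Fin d) ℝ (s j)‖ ≤
        (cnNorm n K f).toReal := by
    rw [← toReal_enorm]
    refine ENNReal.toReal_mono h (le_iSup₂_of_le x hx (le_iSup₂_of_le k hk ?_))
    simp only [EuclideanSpace.basisFun_apply]
    exact le_iSup (fun s : Fin k → Fin d =>
      ‖iteratedFDeriv ℝ k f x fun j => EuclideanSpace.single (s j) (1 : ℝ)‖ₑ) s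
  simpa only [Fintype.card_fin] using opNorm_le_of_orthonormalBasis
    (EuclideanSpace.basisFun (Fin d) ℝ) _ ENNReal.toReal_nonneg hpartial

theorem cnNorm_le_ofReal {B : ℝ} (hB : ∀ x ∈ K, ∀ k ≤ n, ‖iteratedFDeriv ℝ k f x‖ ≤ B) :
    cnNorm n K f ≤ ENNReal.ofReal B := by
  refine iSup₂_le fun x hx => iSup₂_le fun k hk => iSup_le fun s => ?_
  rw [← ofReal_norm]
  refine ENNReal.ofReal_le_ofReal (((iteratedFDeriv ℝ k f x).le_opNorm _).trans ?_)
  simpa using hB x hx k hk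

end Coordinates

section Symbol

variable {d : ℕ} {X : Opens (Euc d)} {ψ χ : Euc d → Euc d}

theorem IsSymbol.differentiableAt (h : IsSymbol X ψ) {x : Euc d} (hx : x ∈ X) :
    DifferentiableAt ℝ ψ x :=
  (h.contDiffAt hx).differentiableAt (by simp)

theorem IsSymbol.contDiffAt_inv (h : IsSymbol X ψ) {y : Euc d} (hy : y ∈ X) :
    ContDiffAt ℝ ∞ (invSymbol X ψ) y :=
  h.contDiffOn_inv.contDiffAt (X.isOpen.mem_nhds hy)

theorem IsSymbol.contDiffAt_weight (h : IsSymbol X ψ) {y : Euc d} (hy : y ∈ X) :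
    ContDiffAt ℝ ∞ (weight X ψ) y :=
  h.contDiffOn_weight.contDiffAt (X.isOpen.mem_nhds hy)

theorem IsSymbol.det_fderiv_comp (hχ : IsSymbol X χ) (h : IsSymbol X ψ) {x : Euc d}
    (hx : x ∈ X) :
    (fderiv ℝ (χ ∘ ψ) x).det = (fderiv ℝ χ (ψ x)).det * (fderiv ℝ ψ x).det := by
  rw [fderiv_comp x (hχ.differentiableAt (h.bij.mapsTo hx)) (h.differentiableAt hx)]
  exact LinearMap.det_comp _ _

theorem isSymbol_id (X : Opens (Euc d)) : IsSymbol X id where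
  smooth := contDiffOn_id
  bij := bijOn_id _
  det_ne x _ := by
    rw [fderiv_id]
    exact LinearMap.det_id.trans_ne one_ne_zero

theorem IsSymbol.comp (hχ : IsSymbol X χ) (h : IsSymbol X ψ) : IsSymbol X (χ ∘ ψ) where
  smooth := hχ.smooth.comp h.smooth h.bij.mapsTo
  bij := hχ.bij.comp h.bij
  det_ne x hx := by
    rw [hχ.det_fderiv_comp h hx]
    exact mul_ne_zero (hχ.det_ne _ (h.bij.mapsTo hx)) (h.det_ne x hx)

theorem IsSymbol.iterate (h : IsSymbol X ψ) (m : ℕ) : IsSymbol X ψ^[m] := by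
  induction m with
  | zero => exact isSymbol_id X
  | succ m ih => exact ih.comp h

theorem IsSymbol.iterate_inv_apply (h : IsSymbol X ψ) (m : ℕ) {x : Euc d} (hx : x ∈ X) :
    (invSymbol X ψ)^[m] (ψ^[m] x) = x := by
  induction m generalizing x with
  | zero => rfl
  | succ m ih =>
    rw [Function.iterate_succ_apply', Function.iterate_succ_apply, ih (h.bij.mapsTo hx),
      h.inv_apply hx]

theorem IsSymbol.invSymbol_iterate (h : IsSymbol X ψ) (m : ℕ) {y : Euc d} (hy : y ∈ X) :
    invSymbol X ψ^[m] y = (invSymbol X ψ)^[m] y := by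
  conv_rhs => rw [← (h.iterate m).apply_inv hy]
  rw [h.iterate_inv_apply m ((h.iterate m).inv_mem hy)]

theorem IsSymbol.invSymbol_iterate_eventuallyEq (h : IsSymbol X ψ) (m : ℕ) {y : Euc d}
    (hy : y ∈ X) : invSymbol X ψ^[m] =ᶠ[𝓝 y] (invSymbol X ψ)^[m] := by
  filter_upwards [X.isOpen.mem_nhds hy] with z hz using h.invSymbol_iterate m hz

theorem IsSymbol.weight_pos (h : IsSymbol X ψ) {y : Euc d} (hy : y ∈ X) : 0 < weight X ψ y :=
  inv_pos.2 (abs_pos.2 (h.det_ne _ (h.inv_mem hy)))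

theorem IsSymbol.weight_apply (h : IsSymbol X ψ) {x : Euc d} (hx : x ∈ X) :
    weight X ψ (ψ x) = |(fderiv ℝ ψ x).det|⁻¹ := by
  rw [weight, h.inv_apply hx]

theorem IsSymbol.weight_comp_apply (hχ : IsSymbol X χ) (h : IsSymbol X ψ) {x : Euc d}
    (hx : x ∈ X) : weight X (χ ∘ ψ) (χ (ψ x)) = weight X χ (χ (ψ x)) * weight X ψ (ψ x) := by
  rw [h.weight_apply hx, hχ.weight_apply (h.bij.mapsTo hx), ← mul_inv, ← abs_mul,
    ← hχ.det_fderiv_comp h hx]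
  exact (hχ.comp h).weight_apply hx

theorem weight_id {x : Euc d} (hx : x ∈ X) : weight X id x = 1 := by
  have hdet : (ContinuousLinearMap.id ℝ (Euc d)).det = 1 := LinearMap.det_id
  simpa [hdet] using (isSymbol_id X).weight_apply hx

theorem IsSymbol.weight_eq_abs_det_fderiv_inv (h : IsSymbol X ψ) {y : Euc d} (hy : y ∈ X) :
    weight X ψ y = |(fderiv ℝ (invSymbol X ψ) y).det| := by
  have hid : (fderiv ℝ ψ (invSymbol X ψ y)).comp (fderiv ℝ (invSymbol X ψ) y) =
      ContinuousLinearMap.id ℝ (Euc d) := by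
    rw [← fderiv_comp y (h.differentiableAt (h.inv_mem hy))
      ((h.contDiffAt_inv hy).differentiableAt (by simp)), ← fderiv_id (𝕜 := ℝ) (x := y)]
    refine Filter.EventuallyEq.fderiv_eq ?_
    filter_upwards [X.isOpen.mem_nhds hy] with z hz using h.apply_inv hz
  have hdet : (fderiv ℝ ψ (invSymbol X ψ y)).det * (fderiv ℝ (invSymbol X ψ) y).det = 1 :=
    (LinearMap.det_comp _ _).symm.trans
      ((congrArg ContinuousLinearMap.det hid).trans LinearMap.det_id)
  rw [weight]
  refine inv_eq_of_mul_eq_one_right ?_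
  rw [← abs_mul, hdet, abs_one]

theorem exists_norm_iteratedFDeriv_weight_le (d n : ℕ) (D : ℝ) :
    ∃ A, 0 ≤ A ∧ ∀ (X : Opens (Euc d)) (ψ : Euc d → Euc d), IsSymbol X ψ → ∀ y ∈ X,
      (∀ k ≤ n + 1, ‖iteratedFDeriv ℝ k (invSymbol X ψ) y‖ ≤ D) →
        ∀ k ≤ n, ‖iteratedFDeriv ℝ k (weight X ψ) y‖ ≤ A := by
  obtain ⟨A, hA0, hA⟩ := exists_norm_iteratedFDeriv_comp_le (E := Euc d) isOpen_univ
    (contDiff_det (d := d)).contDiffOn (isCompact_closedBall (0 : Euc d →L[ℝ] Euc d) D)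
    (subset_univ _) n D
  refine ⟨A, hA0, fun X ψ h y hy hD k hk => ?_⟩
  have hfderiv : ContDiffAt ℝ ∞ (fderiv ℝ (invSymbol X ψ)) y :=
    (h.contDiffAt_inv hy).fderiv_right (by simp)
  have hweight : weight X ψ =ᶠ[𝓝 y] fun z => |(fderiv ℝ (invSymbol X ψ) z).det| := by
    filter_upwards [X.isOpen.mem_nhds hy] with z hz using h.weight_eq_abs_det_fderiv_inv hz
  have hdet : (fderiv ℝ (invSymbol X ψ) y).det ≠ 0 :=
    abs_pos.1 ((h.weight_pos hy).trans_eq hweight.self_of_nhds)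
  have hcont : ContinuousAt (fun z => (fderiv ℝ (invSymbol X ψ) z).det) y :=
    contDiff_det.continuous.continuousAt.comp hfderiv.continuousAt
  rw [(hweight.iteratedFDeriv ℝ k).eq_of_nhds, norm_iteratedFDeriv_abs hcont hdet]
  refine hA _ y (hfderiv.of_le (by exact_mod_cast le_top)) ?_ (fun j hj => ?_) k hk
  · simpa [norm_iteratedFDeriv_one] using hD 1 (by omega)
  · rw [norm_iteratedFDeriv_fderiv]
    exact hD _ (by omega)

end Symbol

section Push

variable {d : ℕ} {X : Opens (Euc d)} {ψ χ : Euc d → Euc d}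

theorem pushFun_of_notMem {φ : Euc d → ℂ} {y : Euc d} (hy : y ∉ X) : pushFun X ψ φ y = 0 :=
  Set.indicator_of_notMem (s := (X : Set (Euc d))) hy _

theorem IsSymbol.pushFun_apply (h : IsSymbol X ψ) (φ : Euc d → ℂ) {x : Euc d} (hx : x ∈ X) :
    pushFun X ψ φ (ψ x) = weight X ψ (ψ x) • φ x := by
  rw [pushFun_of_mem (h.bij.mapsTo hx), h.inv_apply hx]

theorem pushFun_id {φ : Euc d → ℂ} (hφ : Function.support φ ⊆ X) : pushFun X id φ = φ := by
  funext y
  by_cases hy : y ∈ X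
  · simpa [weight_id hy] using (isSymbol_id X).pushFun_apply φ hy
  · rw [pushFun_of_notMem hy, Function.notMem_support.1 fun hy' => hy (hφ hy')]

theorem IsSymbol.pushFun_comp (hχ : IsSymbol X χ) (h : IsSymbol X ψ) (φ : Euc d → ℂ) :
    pushFun X (χ ∘ ψ) φ = pushFun X χ (pushFun X ψ φ) := by
  funext y
  by_cases hy : y ∈ X
  · obtain ⟨x, hx, rfl⟩ := (hχ.comp h).bij.surjOn hy
    rw [(hχ.comp h).pushFun_apply φ hx, Function.comp_apply,
      hχ.pushFun_apply _ (h.bij.mapsTo hx), h.pushFun_apply φ hx, hχ.weight_comp_apply h hx,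
      mul_smul]
  · rw [pushFun_of_notMem hy, pushFun_of_notMem hy]

theorem pushTest_iterate (h : IsSymbol X ψ) (m : ℕ) : pushTest (h.iterate m) = pushTest h ^ m := by
  induction m with
  | zero =>
    ext φ y
    exact congrFun (pushFun_id ((subset_tsupport φ).trans φ.tsupport_subset)) y
  | succ m ih =>
    ext φ y
    rw [pow_succ, ← ih]
    exact congrFun ((h.iterate m).pushFun_comp h φ) y

theorem IsSymbol.pushTest_pow_apply (h : IsSymbol X ψ) (m : ℕ) (φ : 𝓓(X, ℂ)) {x : Euc d}
    (hx : x ∈ X) :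
    (pushTest h ^ m) φ (ψ^[m] x) = weight X ψ^[m] (ψ^[m] x) • φ x := by
  rw [← pushTest_iterate]
  exact (h.iterate m).pushFun_apply φ hx

theorem IsSymbol.integral_norm_pushTest (h : IsSymbol X ψ) (φ : 𝓓(X, ℂ)) :
    ∫ y, ‖pushTest h φ y‖ = ∫ x, ‖φ x‖ := by
  have hX (θ : 𝓓(X, ℂ)) : ∫ y in (X : Set (Euc d)), ‖θ y‖ = ∫ y, ‖θ y‖ :=
    setIntegral_eq_integral_of_forall_compl_eq_zero fun y hy => by
      rw [image_eq_zero_of_notMem_tsupport fun hy' => hy (θ.tsupport_subset hy'), norm_zero]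
  have hchange := integral_image_eq_integral_abs_det_fderiv_smul volume X.isOpen.measurableSet
    (fun x hx => (h.differentiableAt hx).hasFDerivAt.hasFDerivWithinAt)
    h.bij.injOn fun y => ‖pushTest h φ y‖
  rw [h.bij.image_eq, hX] at hchange
  rw [hchange, ← hX]
  refine setIntegral_congr_fun X.isOpen.measurableSet fun x hx => ?_
  have hdet : |(fderiv ℝ ψ x).det| ≠ 0 := abs_ne_zero.2 (h.det_ne x hx)
  simp only [pushTest_apply, h.pushFun_apply φ hx, h.weight_apply hx, norm_smul, norm_inv,
    Real.norm_eq_abs, abs_abs, smul_eq_mul, mul_inv_cancel_left₀ hdet]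

end Push

section Equicontinuity

variable {E F : Type*} [NormedAddCommGroup E] [NormedSpace ℝ E] [NormedAddCommGroup F]
  [NormedSpace ℝ F] {Ω : Opens E}

theorem exists_seminorm_le_mul_of_support_subset {r : Seminorm ℝ 𝓓(Ω, F)} (hr : Continuous r)
    {L : Set E} (hL : IsCompact L) (hLΩ : L ⊆ Ω) :
    ∃ (s : Finset ℕ) (C : NNReal), ∀ (φ : 𝓓(Ω, F)) (M : ℝ), 0 ≤ M → Function.support φ ⊆ L →
      (∀ i ∈ s, ∀ x, ‖iteratedFDeriv ℝ i φ x‖ ≤ M) → r φ ≤ C * M := by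
  let L' : Compacts E := ⟨L, hL⟩
  let rL : Seminorm ℝ 𝓓_{L'}(E, F) :=
    r.comp (TestFunction.ofSupportedInCLM ℝ (K := L') hLΩ).toLinearMap
  obtain ⟨s, C, -, hC⟩ := Seminorm.bound_of_continuous
    (ContDiffMapSupportedIn.withSeminorms ℝ E F ⊤ L') rL
    (hr.comp (TestFunction.continuous_ofSupportedIn (K := L') hLΩ))
  refine ⟨s, C, fun φ M hM hφL hφM => ?_⟩
  let φL : 𝓓_{L'}(E, F) := .of_support_subset φ.contDiff hφL
  refine (hC φL).trans (mul_le_mul_of_nonneg_left ?_ C.2)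
  exact Seminorm.finset_sup_apply_le hM fun i hi =>
    (ContDiffMapSupportedIn.seminorm_top_le_iff ℝ hM i φL).2 fun x _ => hφM i hi x

theorem isVonNBounded_iUnion_image_of_seminorm_le {𝕜 ι : Type*} [RCLike 𝕜] [NormedSpace 𝕜 F]
    [IsScalarTower ℝ 𝕜 F] {T : ι → 𝓓(Ω, F) →L[𝕜] 𝓓(Ω, F)}
    (hT : ∀ r : Seminorm ℝ 𝓓(Ω, F), Continuous r →
      ∃ R : Seminorm ℝ 𝓓(Ω, F), Continuous R ∧ ∀ i φ, r (T i φ) ≤ R φ)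
    {B : Set 𝓓(Ω, F)} (hB : Bornology.IsVonNBounded 𝕜 B) :
    Bornology.IsVonNBounded 𝕜 (⋃ i, T i '' B) := by
  refine isVonNBounded_iUnion_image_of_equicontinuous (fun V hV => ?_) hB
  obtain ⟨s, ε, hε, hsV⟩ :=
    ((PolynormableSpace.withSeminorms ℝ 𝓓(Ω, F)).mem_nhds_iff 0 V).1 hV
  obtain ⟨R, hR, hTR⟩ := hT _ (Seminorm.continuous_finsetSup (s := s) fun r _ => r.2)
  filter_upwards [hR.continuousAt.eventually_lt_const ((map_zero R).trans_lt hε)] with φ hφ i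
  exact hsV ((Seminorm.mem_ball_zero _).2 ((hTR i φ).trans_lt hφ))

end Equicontinuity

section Sufficiency

variable {d : ℕ} {X : Opens (Euc d)} {ψ : Euc d → Euc d}

/-- The second half of condition (ii): `sup_m ‖(ψ⁻ᵐ)_c‖_{n, ψᵐ(K)} < ∞` for every compact
`K ⊆ X`, every order `n` and every component `c`. -/
def InverseDerivBounded (X : Opens (Euc d)) (ψ : Euc d → Euc d) : Prop :=
  ∀ K ⊆ (X : Set (Euc d)), IsCompact K → ∀ (n : ℕ) (c : Fin d),
    (⨆ m : ℕ, cnNorm n (ψ^[m] '' K) (fun y => (((invSymbol X ψ)^[m]) y) c)) < ⊤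

theorem InverseDerivBounded.exists_norm_iteratedFDeriv_le (hb : InverseDerivBounded X ψ)
    (h : IsSymbol X ψ) {K : Set (Euc d)} (hKX : K ⊆ X) (hK : IsCompact K) (n : ℕ) :
    ∃ D : ℝ, ∀ m, ∀ y ∈ ψ^[m] '' K, ∀ k ≤ n,
      ‖iteratedFDeriv ℝ k (invSymbol X ψ^[m]) y‖ ≤ D := by
  let M (c : Fin d) : ℝ≥0∞ := ⨆ m, cnNorm n (ψ^[m] '' K) fun y => (invSymbol X ψ)^[m] y c
  have hM (c : Fin d) : M c ≠ ⊤ := (hb K hKX hK n c).ne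
  refine ⟨∑ c, (d + 1 : ℝ) ^ n * (M c).toReal, fun m y hy k hk => ?_⟩
  have hyX : y ∈ X := (h.iterate m).image_subset hKX hy
  have hle (c : Fin d) : cnNorm n (ψ^[m] '' K) (fun y => (invSymbol X ψ)^[m] y c) ≤ M c :=
    le_iSup (fun m => cnNorm n (ψ^[m] '' K) fun y => (invSymbol X ψ)^[m] y c) m
  refine (norm_iteratedFDeriv_le_sum_coord (((h.iterate m).contDiffAt_inv hyX).of_le
    (by exact_mod_cast le_top))).trans (Finset.sum_le_sum fun c _ => ?_)
  have hcoord : (fun y => invSymbol X ψ^[m] y c) =ᶠ[𝓝 y] fun y => (invSymbol X ψ)^[m] y c :=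
    (h.invSymbol_iterate_eventuallyEq m hyX).fun_comp (· c)
  rw [(hcoord.iteratedFDeriv ℝ k).eq_of_nhds]
  refine (norm_iteratedFDeriv_le_of_cnNorm_ne_top ((hle c).trans_lt (hM c).lt_top).ne hy hk).trans
    (mul_le_mul ?_ (ENNReal.toReal_mono (hM c) (hle c)) ENNReal.toReal_nonneg (by positivity))
  calc (d : ℝ) ^ k ≤ (d + 1 : ℝ) ^ k := by gcongr; linarith
    _ ≤ (d + 1 : ℝ) ^ n := pow_le_pow_right₀ (by simp) hk

theorem exists_seminorm_norm_iteratedFDeriv_pushFun_iterate_le (h : IsSymbol X ψ)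
    (hb : InverseDerivBounded X ψ) (K : Compacts (Euc d)) (hKX : (K : Set (Euc d)) ⊆ X) (i : ℕ) :
    ∃ P : Seminorm ℝ 𝓓_{K}(Euc d, ℂ), Continuous P ∧ ∀ (m : ℕ) (φ : 𝓓_{K}(Euc d, ℂ)) (y : Euc d),
      ‖iteratedFDeriv ℝ i (pushFun X ψ^[m] φ) y‖ ≤ P φ := by
  obtain ⟨D, hD⟩ := hb.exists_norm_iteratedFDeriv_le h hKX K.isCompact (i + 1)
  obtain ⟨A, hA0, hA⟩ := exists_norm_iteratedFDeriv_weight_le d i D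
  let C : NNReal := ⟨∑ k ∈ Finset.range (i + 1),
    (i.choose k : ℝ) * A * ((i - k).factorial * (max 1 D) ^ (i - k)),
    Finset.sum_nonneg fun k _ => by positivity⟩
  let p (k : ℕ) := ContDiffMapSupportedIn.seminorm ℝ (Euc d) ℂ ⊤ K k
  refine ⟨C • (Finset.range (i + 1)).sup p, (Seminorm.continuous_finsetSup fun k _ =>
    (ContDiffMapSupportedIn.withSeminorms ℝ (Euc d) ℂ ⊤ K).continuous_seminorm k).const_smul C,
    fun m φ y => ?_⟩
  have hm := h.iterate m
  by_cases hy : y ∈ ψ^[m] '' (K : Set (Euc d))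
  · have hyX : y ∈ X := hm.image_subset hKX hy
    have hpush : pushFun X ψ^[m] φ =ᶠ[𝓝 y]
        fun y => weight X ψ^[m] y • φ (invSymbol X ψ^[m] y) := by
      filter_upwards [X.isOpen.mem_nhds hyX] with z hz using pushFun_of_mem hz
    have hle : (i : ℕ∞ω) ≤ (∞ : ℕ∞ω) := by exact_mod_cast le_top
    rw [(hpush.iteratedFDeriv ℝ i).eq_of_nhds]
    refine norm_iteratedFDeriv_smul_comp_le ((hm.contDiffAt_weight hyX).of_le hle)
      ((hm.contDiffAt_inv hyX).of_le hle) (φ.contDiff.contDiffAt.of_le hle)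
      (hA X _ hm y hyX (hD m y hy)) (fun k hk hki => ?_) fun k hk => ?_
    · exact (hD m y hy k (by omega)).trans
        ((le_max_right 1 D).trans (le_self_pow₀ (le_max_left 1 D) (by omega)))
    · exact (ContDiffMapSupportedIn.norm_iteratedFDeriv_apply_le_seminorm_top ℝ).trans
        (Seminorm.le_finset_sup_apply (p := p) (Finset.mem_range.2 (Nat.lt_succ_of_le hk)))
  · have hpush : pushFun X ψ^[m] φ =ᶠ[𝓝 y] fun _ => (0 : ℂ) := by
      filter_upwards [(hm.isCompact_image K.isCompact hKX).isClosed.isOpen_compl.mem_nhds hy]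
        with z hz
      exact Function.notMem_support.1 fun hz' => hz (hm.support_pushFun φ.support_subset hz')
    rw [(hpush.iteratedFDeriv ℝ i).eq_of_nhds, iteratedFDeriv_fun_zero, Pi.zero_apply, norm_zero]
    exact apply_nonneg _ φ

theorem exists_seminorm_pushTest_pow_le (h : IsSymbol X ψ) (hs : StableOrbits (X : Set (Euc d)) ψ)
    (hb : InverseDerivBounded X ψ) {r : Seminorm ℝ 𝓓(X, ℂ)} (hr : Continuous r) :
    ∃ R : Seminorm ℝ 𝓓(X, ℂ), Continuous R ∧ ∀ m φ, r ((pushTest h ^ m) φ) ≤ R φ := by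
  let p (m : ℕ) : Seminorm ℝ 𝓓(X, ℂ) :=
    r.comp ((pushTest h ^ m).toLinearMap.restrictScalars ℝ)
  suffices ∃ R : Seminorm ℝ 𝓓(X, ℂ), Continuous R ∧ ∀ m, p m ≤ R from this
  refine exists_continuous_seminorm_forall_le p fun K hKX => ?_
  obtain ⟨L, hLX, hL, hKL⟩ := hs K hKX K.isCompact
  obtain ⟨s, C, hC⟩ := exists_seminorm_le_mul_of_support_subset hr hL hLX
  choose P hP hPbound using
    exists_seminorm_norm_iteratedFDeriv_pushFun_iterate_le h hb K hKX
  refine ⟨C • s.sup P, (Seminorm.continuous_finsetSup fun i _ => hP i).const_smul C,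
    fun m φ => ?_⟩
  change r ((pushTest h ^ m) (TestFunction.ofSupportedIn hKX φ)) ≤ C * s.sup P φ
  rw [← pushTest_iterate]
  refine hC _ _ (apply_nonneg _ _) (((h.iterate m).support_pushFun φ.support_subset).trans
    (hKL m)) fun i hi y => (hPbound i m φ y).trans (Seminorm.le_finset_sup_apply hi)

theorem powerBounded_of_stableOrbits (h : IsSymbol X ψ) (hs : StableOrbits (X : Set (Euc d)) ψ)
    (hb : InverseDerivBounded X ψ) : PowerBounded (compOp h) :=
  powerBounded_precomp fun _ => isVonNBounded_iUnion_image_of_seminorm_le fun _ =>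
    exists_seminorm_pushTest_pow_le h hs hb

end Sufficiency

section Orbits

variable {E : Type*} [NormedAddCommGroup E] [NormedSpace ℝ E] {Ω : Opens E}
  {T : 𝓓(Ω, ℂ) →L[ℂ] 𝓓(Ω, ℂ)}

theorem PowerBounded.exists_isCompact_support_subset [ProperSpace E]
    (hT : PowerBounded (E := 𝓓(Ω, ℂ) →L[ℂ] ℂ) (ContinuousLinearMap.precomp ℂ T))
    (φ : 𝓓(Ω, ℂ)) :
    ∃ L ⊆ (Ω : Set E), IsCompact L ∧ ∀ m : ℕ, Function.support ((T ^ m) φ) ⊆ L := by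
  obtain ⟨B, hB, hBφ⟩ := hT.exists_isVonNBounded_forall_norm_le φ
  obtain ⟨L, hLΩ, hL, hBL⟩ := exists_isCompact_support_subset_of_isVonNBounded hB
  refine ⟨L, hLΩ, hL, fun m y hy => by_contra fun hyL => hy (norm_le_zero_iff.1 ?_)⟩
  refine hBφ (directionalDerivAt ℂ Ω 0 y 0) 0 le_rfl (fun χ hχ => norm_le_zero_iff.2 ?_) m
  exact Function.notMem_support.1 fun hχy => hyL (hBL χ hχ hχy)

theorem PowerBounded.exists_norm_iteratedFDeriv_le
    (hT : PowerBounded (E := 𝓓(Ω, ℂ) →L[ℂ] ℂ) (ContinuousLinearMap.precomp ℂ T))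
    (φ : 𝓓(Ω, ℂ)) (i : ℕ) :
    ∃ M : ℝ, 0 ≤ M ∧ ∀ (m : ℕ) (x : E), ‖iteratedFDeriv ℝ i ((T ^ m) φ) x‖ ≤ M := by
  obtain ⟨B, hB, hBφ⟩ := hT.exists_isVonNBounded_forall_norm_le φ
  obtain ⟨M, hM0, hM⟩ := exists_norm_iteratedFDeriv_le_of_isVonNBounded i hB
  refine ⟨M, hM0, fun m x => ContinuousMultilinearMap.opNorm_le_bound hM0 fun v => ?_⟩
  exact hBφ (directionalDerivAt ℂ Ω i x v) _ (by positivity)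
    (fun χ hχ => ContinuousMultilinearMap.le_of_opNorm_le (hM χ hχ x) v) m

theorem PowerBounded.exists_norm_iteratedFDeriv_le_of_le
    (hT : PowerBounded (E := 𝓓(Ω, ℂ) →L[ℂ] ℂ) (ContinuousLinearMap.precomp ℂ T))
    (φ : 𝓓(Ω, ℂ)) (n : ℕ) :
    ∃ M : ℝ, ∀ (m : ℕ) (x : E), ∀ k ≤ n, ‖iteratedFDeriv ℝ k ((T ^ m) φ) x‖ ≤ M := by
  choose M hM0 hM using hT.exists_norm_iteratedFDeriv_le φ
  refine ⟨∑ k ∈ Finset.range (n + 1), M k, fun m x k hk => (hM k m x).trans ?_⟩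
  exact Finset.single_le_sum (fun k _ => hM0 k) (Finset.mem_range.2 (Nat.lt_succ_of_le hk))

theorem PowerBounded.exists_norm_le
    (hT : PowerBounded (E := 𝓓(Ω, ℂ) →L[ℂ] ℂ) (ContinuousLinearMap.precomp ℂ T))
    (φ : 𝓓(Ω, ℂ)) : ∃ M : ℝ, 0 ≤ M ∧ ∀ (m : ℕ) (x : E), ‖(T ^ m) φ x‖ ≤ M := by
  simpa only [norm_iteratedFDeriv_zero] using hT.exists_norm_iteratedFDeriv_le φ 0

theorem PowerBounded.exists_lipschitzWith
    (hT : PowerBounded (E := 𝓓(Ω, ℂ) →L[ℂ] ℂ) (ContinuousLinearMap.precomp ℂ T))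
    (φ : 𝓓(Ω, ℂ)) : ∃ C : NNReal, ∀ m : ℕ, LipschitzWith C ((T ^ m) φ) := by
  obtain ⟨M, hM0, hM⟩ := hT.exists_norm_iteratedFDeriv_le φ 1
  refine ⟨⟨M, hM0⟩, fun m => lipschitzWith_of_nnnorm_fderiv_le
    (((T ^ m) φ).contDiff.differentiable (by simp)) fun x => ?_⟩
  exact (norm_iteratedFDeriv_one (𝕜 := ℝ) _).symm.trans_le (hM m x)

end Orbits

section Recurrence

theorem exists_add_le_forall_dist_le_of_lipschitzWith {α Y : Type*} [PseudoMetricSpace α]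
    [NormedAddCommGroup Y] [ProperSpace Y] {f : ℕ → α → Y} {L : Set α} (hL : IsCompact L)
    (hsupp : ∀ m, Function.support (f m) ⊆ L) {M : ℝ} (hM : ∀ m x, ‖f m x‖ ≤ M) {C : NNReal}
    (hC : ∀ m, LipschitzWith C (f m)) (N : ℕ) {ε : ℝ} (hε : 0 < ε) :
    ∃ a b, a + N ≤ b ∧ ∀ x, dist (f b x) (f a x) ≤ ε := by
  have : CompactSpace L := isCompact_iff_compactSpace.1 hL
  let g (m : ℕ) : BoundedContinuousFunction L Y := .mkOfCompact
    ⟨fun x => f m x, (hC m).continuous.comp continuous_subtype_val⟩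
  have hcomp : IsCompact (closure (range g)) := by
    refine BoundedContinuousFunction.arzela_ascoli (Metric.closedBall (0 : Y) M)
      (isCompact_closedBall _ _) _ ?_ (LipschitzWith.uniformEquicontinuous _ C ?_).equicontinuous
    · rintro _ x ⟨m, rfl⟩
      exact mem_closedBall_zero_iff.2 (hM m x)
    · rintro ⟨_, m, rfl⟩
      exact fun x y => hC m x y
  obtain ⟨_, -, θ, hθ, hlim⟩ := hcomp.tendsto_subseq fun m => subset_closure (mem_range_self m)
  obtain ⟨k, hk⟩ := Metric.cauchySeq_iff.1 hlim.cauchySeq ε hε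
  refine ⟨θ k, θ (N + k), by have := hθ.add_le_nat N k; omega, fun x => ?_⟩
  by_cases hx : x ∈ L
  · exact (BoundedContinuousFunction.dist_coe_le_dist (⟨x, hx⟩ : L)).trans
      (hk (N + k) (by omega) k le_rfl).le
  · have hzero (m : ℕ) : f m x = 0 := Function.notMem_support.1 fun hm => hx (hsupp m hm)
    rw [hzero, hzero, dist_self]
    exact hε.le

theorem integral_norm_le_mul_measureReal_of_support_subset {α F : Type*} [MeasurableSpace α]
    {μ : Measure α} [NormedAddCommGroup F] {f : α → F} {L : Set α}
    (hf : Function.support f ⊆ L) (hL : μ L < ⊤) {η : ℝ} (hη : ∀ x ∈ L, ‖f x‖ ≤ η) :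
    ∫ x, ‖f x‖ ∂μ ≤ η * μ.real L := by
  rw [← setIntegral_eq_integral_of_forall_compl_eq_zero (s := L) fun x hx => by
    rw [Function.notMem_support.1 fun hx' => hx (hf hx'), norm_zero]]
  exact (le_abs_self _).trans (norm_setIntegral_le_of_norm_le_const hL fun x hx =>
    (norm_norm (f x)).trans_le (hη x hx))

variable {E : Type*} [NormedAddCommGroup E] [MeasurableSpace E] {μ : Measure E}

theorem exists_le_integral_norm_of_lipschitzWith {F : Type*} [NormedAddCommGroup F]
    [NormedSpace ℝ E] [FiniteDimensional ℝ E] [BorelSpace E] [μ.IsAddHaarMeasure]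
    (C : NNReal) {ε : ℝ} (hε : 0 < ε) :
    ∃ δ, 0 < δ ∧ ∀ g : E → F, Integrable g μ → LipschitzWith C g → ∀ x, ε ≤ ‖g x‖ →
      δ ≤ ∫ z, ‖g z‖ ∂μ := by
  let r : ℝ := ε / (2 * (C + 1))
  have hr : 0 < r := by positivity
  refine ⟨μ.real (Metric.ball 0 r) * (ε / 2), mul_pos (ENNReal.toReal_pos
    (Metric.measure_ball_pos _ _ hr).ne' measure_ball_lt_top.ne) (half_pos hε),
    fun g hg hC x hx => ?_⟩
  have hball : ∀ z ∈ Metric.ball x r, ε / 2 ≤ ‖g z‖ := fun z hz => by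
    have hdist : ‖g x - g z‖ ≤ ε / 2 := calc
      ‖g x - g z‖ ≤ C * ‖x - z‖ := hC.norm_sub_le x z
      _ ≤ (C + 1) * r := by
        gcongr
        · exact le_add_of_nonneg_right zero_le_one
        · exact (mem_ball_iff_norm'.1 hz).le
      _ = ε / 2 := by simp only [r]; field_simp
    linarith [norm_sub_norm_le (g x) (g z)]
  calc μ.real (Metric.ball 0 r) * (ε / 2)
      = ∫ _ in Metric.ball x r, ε / 2 ∂μ := by
        rw [setIntegral_const, measureReal_def, measureReal_def, Measure.addHaar_ball_center μ x,
          smul_eq_mul]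
    _ ≤ ∫ z in Metric.ball x r, ‖g z‖ ∂μ :=
        setIntegral_mono_on (integrableOn_const measure_ball_lt_top.ne) hg.norm.integrableOn
          measurableSet_ball hball
    _ ≤ ∫ z, ‖g z‖ ∂μ :=
        setIntegral_le_integral hg.norm (Eventually.of_forall fun _ => norm_nonneg _)

variable [NormedSpace ℝ E] {Ω : Opens E} {T : 𝓓(Ω, ℂ) →L[ℂ] 𝓓(Ω, ℂ)}

theorem integral_norm_pow_apply (hμ : ∀ φ, ∫ x, ‖T φ x‖ ∂μ = ∫ x, ‖φ x‖ ∂μ) (m : ℕ)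
    (φ : 𝓓(Ω, ℂ)) : ∫ x, ‖(T ^ m) φ x‖ ∂μ = ∫ x, ‖φ x‖ ∂μ := by
  induction m with
  | zero => rfl
  | succ m ih =>
    rw [pow_succ']
    exact (hμ _).trans ih

theorem integral_norm_pow_sub_pow (hμ : ∀ φ, ∫ x, ‖T φ x‖ ∂μ = ∫ x, ‖φ x‖ ∂μ) {a b : ℕ}
    (hab : a ≤ b) (φ : 𝓓(Ω, ℂ)) :
    ∫ x, ‖(T ^ b) φ x - (T ^ a) φ x‖ ∂μ = ∫ x, ‖(T ^ (b - a)) φ x - φ x‖ ∂μ := by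
  have hsub : (T ^ a) ((T ^ (b - a)) φ - φ) = (T ^ b) φ - (T ^ a) φ := by
    rw [map_sub, ← mul_apply_eq_comp, ← pow_add, Nat.add_sub_cancel' hab]
  have hiso := integral_norm_pow_apply hμ a ((T ^ (b - a)) φ - φ)
  rwa [hsub] at hiso

theorem PowerBounded.exists_forall_norm_pow_sub_le [FiniteDimensional ℝ E] [BorelSpace E]
    [μ.IsAddHaarMeasure]
    (hT : PowerBounded (E := 𝓓(Ω, ℂ) →L[ℂ] ℂ) (ContinuousLinearMap.precomp ℂ T))
    (hμ : ∀ φ, ∫ x, ‖T φ x‖ ∂μ = ∫ x, ‖φ x‖ ∂μ) (φ : 𝓓(Ω, ℂ)) (N : ℕ) {ε : ℝ} (hε : 0 < ε) :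
    ∃ n ≥ N, ∀ x, ‖(T ^ n) φ x - φ x‖ ≤ ε := by
  have : ProperSpace E := FiniteDimensional.proper_real E
  obtain ⟨L, -, hL, hsupp⟩ := hT.exists_isCompact_support_subset φ
  obtain ⟨M, -, hM⟩ := hT.exists_norm_le φ
  obtain ⟨C, hC⟩ := hT.exists_lipschitzWith φ
  obtain ⟨δ, hδ, hδle⟩ :=
    exists_le_integral_norm_of_lipschitzWith (F := ℂ) (μ := μ) (C + C) hε
  obtain ⟨a, b, hab, hclose⟩ := exists_add_le_forall_dist_le_of_lipschitzWith hL hsupp hM hC N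
    (ε := δ / (2 * (μ.real L + 1))) (by positivity)
  refine ⟨b - a, by omega, fun x => not_lt.1 fun hx => ?_⟩
  have hint (χ : 𝓓(Ω, ℂ)) : Integrable χ μ :=
    χ.continuous.integrable_of_hasCompactSupport χ.hasCompactSupport
  have hle : δ ≤ ∫ y, ‖(T ^ b) φ y - (T ^ a) φ y‖ ∂μ := by
    rw [integral_norm_pow_sub_pow hμ (by omega) φ]
    exact hδle _ ((hint _).sub (hint φ)) ((hC (b - a)).sub (hC 0)) x hx.le
  have hlt : ∫ y, ‖(T ^ b) φ y - (T ^ a) φ y‖ ∂μ < δ := by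
    refine (integral_norm_le_mul_measureReal_of_support_subset
      ((Function.support_sub _ _).trans (union_subset (hsupp b) (hsupp a))) hL.measure_lt_top
      fun y _ => (dist_eq_norm _ _).symm.trans_le (hclose y)).trans_lt ?_
    rw [div_mul_eq_mul_div, div_lt_iff₀ (by positivity)]
    nlinarith [measureReal_nonneg (μ := μ) (s := L)]
  exact hle.not_gt hlt

end Recurrence

section Quotient

theorem exists_norm_iteratedFDeriv_re_div_le {E : Type*} [NormedAddCommGroup E] [NormedSpace ℝ E]
    (n : ℕ) {c : ℝ} (hc : 0 < c) (M : ℝ) :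
    ∃ B, ∀ (f g : E → ℂ) (x : E), ContDiffAt ℝ n f x → ContDiffAt ℝ n g x → c ≤ ‖g x‖ →
      (∀ k ≤ n, ‖iteratedFDeriv ℝ k f x‖ ≤ M) → (∀ k ≤ n, ‖iteratedFDeriv ℝ k g x‖ ≤ M) →
        ∀ k ≤ n, ‖iteratedFDeriv ℝ k (fun z => (f z / g z).re) x‖ ≤ B := by
  have hU : IsOpen {p : ℂ × ℂ | p.2 ≠ 0} := isOpen_ne_fun continuous_snd continuous_const
  have hq : ContDiffOn ℝ ∞ (fun p : ℂ × ℂ => (p.1 / p.2).re) {p | p.2 ≠ 0} :=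
    Complex.reCLM.contDiff.comp_contDiffOn
      ((contDiff_fst.contDiffOn.mul (contDiff_snd.contDiffOn.inv fun _ hp => hp)).congr
        fun _ _ => div_eq_mul_inv _ _)
  have hK : IsCompact (Metric.closedBall (0 : ℂ × ℂ) M ∩ {p | c ≤ ‖p.2‖}) :=
    (isCompact_closedBall _ _).inter_right (isClosed_le continuous_const continuous_snd.norm)
  obtain ⟨B, -, hB⟩ := exists_norm_iteratedFDeriv_comp_le (E := E) hU hq hK
    (fun p hp => norm_pos_iff.1 (hc.trans_le hp.2)) n M
  refine ⟨B, fun f g x hf hg hcx hMf hMg => hB (fun z => (f z, g z)) x (hf.prodMk hg)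
    ⟨?_, hcx⟩ fun k hk => ?_⟩
  · rw [mem_closedBall_zero_iff, ← norm_iteratedFDeriv_zero (𝕜 := ℝ) (f := fun z => (f z, g z)),
      iteratedFDeriv_prodMk hf hg (by simp), ContinuousMultilinearMap.opNorm_prod]
    exact max_le (hMf 0 n.zero_le) (hMg 0 n.zero_le)
  · rw [iteratedFDeriv_prodMk hf hg (by exact_mod_cast hk), ContinuousMultilinearMap.opNorm_prod]
    exact max_le (hMf k hk) (hMg k hk)

variable {d : ℕ} {X : Opens (Euc d)} {ψ : Euc d → Euc d}

/-- The test function `x ↦ x_c φ(x)`; the quotient of its image under the powers of `pushTest h`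
by that of `φ` recovers the component `(ψ⁻ᵐ)_c`. -/
noncomputable def coordMul (c : Fin d) (φ : 𝓓(X, ℂ)) : 𝓓(X, ℂ) :=
  ⟨fun x => ((x c : ℝ) : ℂ) * φ x,
    (Complex.ofRealCLM.contDiff.comp
      (EuclideanSpace.proj c : Euc d →L[ℝ] ℝ).contDiff).mul φ.contDiff,
    φ.hasCompactSupport.mul_left,
    tsupport_mul_subset_right.trans φ.tsupport_subset⟩

theorem coordMul_apply (c : Fin d) (φ : 𝓓(X, ℂ)) (x : Euc d) :
    coordMul c φ x = ((x c : ℝ) : ℂ) * φ x := rfl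

theorem IsSymbol.iterate_inv_apply_eventuallyEq_re_div (h : IsSymbol X ψ) (m : ℕ) (c : Fin d)
    {φ : 𝓓(X, ℂ)} {y : Euc d} (hy : y ∈ X) (hφ : (pushTest h ^ m) φ y ≠ 0) :
    (fun z => (invSymbol X ψ)^[m] z c) =ᶠ[𝓝 y]
      fun z => ((pushTest h ^ m) (coordMul c φ) z / (pushTest h ^ m) φ z).re := by
  filter_upwards [X.isOpen.mem_nhds hy,
    ((pushTest h ^ m) φ).continuous.continuousAt.eventually_ne hφ] with z hz hφz
  obtain ⟨x, hx, rfl⟩ := (h.iterate m).bij.surjOn hz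
  have hcoord : (pushTest h ^ m) (coordMul c φ) (ψ^[m] x) =
      ((x c : ℝ) : ℂ) * (pushTest h ^ m) φ (ψ^[m] x) := by
    rw [h.pushTest_pow_apply m _ hx, h.pushTest_pow_apply m _ hx, coordMul_apply, mul_smul_comm]
  rw [h.iterate_inv_apply m hx, hcoord, mul_div_cancel_right₀ _ hφz, Complex.ofReal_re]

end Quotient

section Necessity

variable {d : ℕ} {X : Opens (Euc d)} {ψ : Euc d → Euc d} {h : IsSymbol X ψ}

theorem IsSymbol.pushTest_pow_apply_of_eq_one (h : IsSymbol X ψ) (m : ℕ) {φ : 𝓓(X, ℂ)} {x : Euc d}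
    (hx : x ∈ X) (hφ : φ x = 1) :
    (pushTest h ^ m) φ (ψ^[m] x) = (weight X ψ^[m] (ψ^[m] x) : ℂ) := by
  rw [h.pushTest_pow_apply m φ hx, hφ, Complex.real_smul, mul_one]

theorem PowerBounded.stableOrbits (hp : PowerBounded (compOp h)) :
    StableOrbits (X : Set (Euc d)) ψ := by
  intro K hKX hK
  obtain ⟨φ, hφ⟩ := exists_testFunction_eqOn_const hK hKX (1 : ℂ)
  obtain ⟨L, hLX, hL, hLφ⟩ := PowerBounded.exists_isCompact_support_subset hp φ
  refine ⟨L, hLX, hL, fun m => ?_⟩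
  rintro _ ⟨x, hx, rfl⟩
  have hm := h.iterate m
  refine hLφ m ?_
  rw [Function.mem_support, h.pushTest_pow_apply_of_eq_one m (hKX hx) (hφ x hx)]
  exact Complex.ofReal_ne_zero.2 (hm.weight_pos (hm.bij.mapsTo (hKX hx))).ne'

theorem PowerBounded.exists_weight_le (hp : PowerBounded (compOp h)) {K : Set (Euc d)}
    (hKX : K ⊆ X) (hK : IsCompact K) :
    ∃ M : ℝ, 0 ≤ M ∧ ∀ (m : ℕ), ∀ x ∈ K, weight X ψ^[m] (ψ^[m] x) ≤ M := by
  obtain ⟨φ, hφ⟩ := exists_testFunction_eqOn_const hK hKX (1 : ℂ)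
  obtain ⟨M, hM0, hM⟩ := PowerBounded.exists_norm_le hp φ
  refine ⟨M, hM0, fun m x hx => (le_abs_self _).trans ?_⟩
  rw [← Real.norm_eq_abs, ← Complex.norm_real,
    ← h.pushTest_pow_apply_of_eq_one m (hKX hx) (hφ x hx)]
  exact hM m _

theorem PowerBounded.exists_half_le_weight (hp : PowerBounded (compOp h)) {K : Set (Euc d)}
    (hKX : K ⊆ X) (hK : IsCompact K) (N : ℕ) :
    ∃ n ≥ N, ∀ x ∈ K, 1 / 2 ≤ weight X ψ^[n] (ψ^[n] x) := by
  obtain ⟨L, hLX, hL, hKL⟩ := hp.stableOrbits K hKX hK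
  obtain ⟨φ, hφ⟩ := exists_testFunction_eqOn_const hL hLX (1 : ℂ)
  obtain ⟨n, hn, hnφ⟩ := PowerBounded.exists_forall_norm_pow_sub_le hp
    h.integral_norm_pushTest φ N one_half_pos
  refine ⟨n, hn, fun x hx => ?_⟩
  have hclose := hnφ (ψ^[n] x)
  rw [h.pushTest_pow_apply_of_eq_one n (hKX hx) (hφ x (hKL 0 ⟨x, hx, rfl⟩)),
    hφ _ (hKL n ⟨x, hx, rfl⟩), ← Complex.ofReal_one, ← Complex.ofReal_sub,
    Complex.norm_real, Real.norm_eq_abs] at hclose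
  linarith [(abs_le.1 hclose).1]

/-- The chain rule splits `ψⁿ` as `ψⁿ⁻ᵐ ∘ ψᵐ`, where `n ≥ m` is a time of return. -/
theorem PowerBounded.exists_pos_le_weight (hp : PowerBounded (compOp h)) {K : Set (Euc d)}
    (hKX : K ⊆ X) (hK : IsCompact K) :
    ∃ c : ℝ, 0 < c ∧ ∀ (m : ℕ), ∀ x ∈ K, c ≤ weight X ψ^[m] (ψ^[m] x) := by
  obtain ⟨L, hLX, hL, hKL⟩ := hp.stableOrbits K hKX hK
  obtain ⟨M, hM0, hM⟩ := hp.exists_weight_le hLX hL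
  refine ⟨1 / (2 * (M + 1)), by positivity, fun m x hx => ?_⟩
  obtain ⟨n, hn, hhalf⟩ := hp.exists_half_le_weight hKX hK m
  have hm := h.iterate m
  have hsplit := (h.iterate (n - m)).weight_comp_apply hm (hKX hx)
  rw [← Function.iterate_add, ← Function.iterate_add_apply, Nat.sub_add_cancel hn] at hsplit
  have hpos := hm.weight_pos (hm.bij.mapsTo (hKX hx))
  have hbound : weight X ψ^[n - m] (ψ^[n] x) ≤ M := by
    simpa only [← Function.iterate_add_apply, Nat.sub_add_cancel hn] using
      hM (n - m) _ (hKL m ⟨x, hx, rfl⟩)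
  rw [div_le_iff₀ (by positivity)]
  nlinarith [hhalf x hx]

theorem PowerBounded.inverseDerivBounded (hp : PowerBounded (compOp h)) :
    InverseDerivBounded X ψ := by
  intro K hKX hK n c
  obtain ⟨w, hw, hlow⟩ := hp.exists_pos_le_weight hKX hK
  obtain ⟨φ, hφ⟩ := exists_testFunction_eqOn_const hK hKX (1 : ℂ)
  obtain ⟨M, hM⟩ := PowerBounded.exists_norm_iteratedFDeriv_le_of_le hp φ n
  obtain ⟨M', hM'⟩ := PowerBounded.exists_norm_iteratedFDeriv_le_of_le hp (coordMul c φ) n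
  obtain ⟨B, hB⟩ := exists_norm_iteratedFDeriv_re_div_le (E := Euc d) n hw (max M M')
  refine (iSup_le fun m => cnNorm_le_ofReal (B := B) ?_).trans_lt ENNReal.ofReal_lt_top
  rintro _ ⟨x, hx, rfl⟩ k hk
  have hlow_push : w ≤ ‖(pushTest h ^ m) φ (ψ^[m] x)‖ := by
    rw [h.pushTest_pow_apply_of_eq_one m (hKX hx) (hφ x hx), Complex.norm_real]
    exact (hlow m x hx).trans (le_abs_self _)
  have hquot := h.iterate_inv_apply_eventuallyEq_re_div m c ((h.iterate m).bij.mapsTo (hKX hx))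
    (norm_pos_iff.1 (hw.trans_le hlow_push))
  have hdiff (χ : 𝓓(X, ℂ)) : ContDiffAt ℝ n χ (ψ^[m] x) :=
    χ.contDiff.contDiffAt.of_le (by exact_mod_cast le_top)
  rw [(hquot.iteratedFDeriv ℝ k).eq_of_nhds]
  exact hB _ _ _ (hdiff _) (hdiff _) hlow_push (fun j hj => (hM' m _ j hj).trans (le_max_right _ _))
    (fun j hj => (hM m _ j hj).trans (le_max_left _ _)) k hk

end Necessity

end CompositionOp

theorem mainTheorem4 {d : ℕ} (X : TopologicalSpace.Opens (CompositionOp.Euc d))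
    (ψ : CompositionOp.Euc d → CompositionOp.Euc d)
    (hψ : ContDiffOn ℝ ∞ ψ X) (hbij : Set.BijOn ψ X X)
    (hdet : ∀ x ∈ X, (fderiv ℝ ψ x).det ≠ 0) :
    CompositionOp.PowerBounded
        (CompositionOp.compOp (CompositionOp.IsSymbol.mk hψ hbij hdet)) ↔
      CompositionOp.StableOrbits (X : Set (CompositionOp.Euc d)) ψ ∧
      ∀ K ⊆ (X : Set (CompositionOp.Euc d)), IsCompact K → ∀ (n : ℕ) (c : Fin d),
        (⨆ m : ℕ, CompositionOp.cnNorm n (ψ^[m] '' K)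
          (fun y => (((CompositionOp.invSymbol X ψ)^[m]) y) c)) < ⊤ :=
  ⟨fun hp => ⟨hp.stableOrbits, hp.inverseDerivBounded⟩,
    fun hs => CompositionOp.powerBounded_of_stableOrbits _ hs.1 hs.2⟩
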